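/- Let $d\ge 4$, let $\bar d=d$ if $d$ is odd and $\bar d=2d$ if $d$ is even, put $\iota=\bar d/d$, let $D$ be the square-free part of $(d-3)(d+1)$, and let $\mathbb K=\mathbb Q(\sqrt D)\subset\mathbb R$ (with $\sqrt D>0$), with ring of integers $\mathcal O_{\mathbb K}$. Let $\omega=e^{2\pi i/d}$, $\tau=-e^{\pi i/d}$, let $w$ be the cyclic shift and $h=\mathrm{diag}(1,\omega,\dots,\omega^{d-1})$ on $\mathbb C^d$, and put $D_{\mathbf p}=\tau^{p_1p_2}w^{p_1}h^{p_2}$ for $\mathbf p\in\mathbb Z_{\bar d}^2$. A unit vector $\mathbf z\in\mathbb C^d$ is a *fiducial* if the $d^2$ points $[w^ah^b\mathbf z]$ satisfy $|\langle\mathbf v,\mathbf v'\rangle|^2=\frac1{d+1}$ for any two distinct unit representatives. Let $\Phi(\mathbf p)=\langle\mathbf z,D_{\mathbf p}\mathbf z\rangle$ and $S=\{G\in GL_2(\mathbb Z_{\bar d}):\Phi\circ G=\Phi\}$. The fiducial is *centred* if $S$ contains an element $F\in SL_2(\mathbb Z_{\bar d})$ of order $3$ and trace $-1$, and every Clifford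 unitary $U$ that fixes $[\mathbf z]$ acts by $UD_{\mathbf p}U^{-1}=D_{G\mathbf p}$ for some $G\in SL_2(\mathbb Z_{\bar d})$. With $\mathbb E_1=\mathbb K(\Phi(\mathbf p):\mathbf p\in\mathbb Z_{\bar d}^2)$ and $\mathbb E=\mathbb K(\tau,\,z_i\overline{z_j})$, a centred fiducial is *strongly centred* if $\mathbb E=\mathbb E_1(i\sqrt{\bar d})$. Let $\mathcal G$ be the group of automorphisms of $\mathbb E_1/\mathbb Q$ that preserve the set $\Phi(\mathbb Z_{\bar d}^2)$, and let $M$ be the group of all $G\in GL_2(\mathbb Z_{\bar d})$ such that $g\circ\Phi=\Phi\circ G$ for some $g\in\mathcal G$. Let $\mathbf z$ be a strongly centred fiducial such that $M$ is a maximal abelian subgroup of the centralizer of $S$, and let $F\in S$ be as above. Say that $F$ is of type $z$ if it is conjugate in $GL_2(\mathbb Z_{\bar d})$ to $F_z=\begin{pmatrix}0&-1\\1&-1\end{pmatrix}$, and of type $a$ otherwise. Let $u_f$ be a fundamental unit of $\mathcal O_{\mathbb K}$, positive in $\mathbb K\subset\mathbb R$, let $u_D$ be the smallest power of $u_f$ of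 norm $1$, let $r\in\mathbb N$ be such that $u_D^r$ has rational part $\frac{d-1}2$, and put $v=u_D^{\iota r}$. For a divisor $n$ of $\bar d$ coprime to $\bar d/n$ let $M_n$ be the image of $M$ in $GL_2(\mathbb Z_n)$. The fiducial is *algebraic* (with respect to $F$) if there is an isomorphism $\hat\jmath:M\to(\mathcal O_{\mathbb K}/(\bar d))^\times$ of the following form. In type $z$, $\hat\jmath(aI+bF)=a+bv$ whenever $aI+bF\in M$. In type $a$ (where $3\mid\bar d$), $\hat\jmath=(j',j^\times)$ under $(\mathcal O_{\mathbb K}/(\bar d))^\times\cong(\mathcal O_{\mathbb K}/(3))^\times\times(\mathcal O_{\mathbb K}/(\bar d/3))^\times$, where the first component is induced by an isomorphism $j':M_3\to(\mathcal O_{\mathbb K}/(3))^\times$ with $j'(cI)=c$ for scalars, and the second maps $G\in M$ to $a+bv$ if $G\equiv aI+bF\pmod{\bar d/3}$. (1) *Algebraic fiducials.* Let $\hat\jmath$ be such an isomorphism. For an ideal factor $\mathfrak n$ of $\bar d$ in $\mathcal O_{\mathbb K}$ let $\pi_{\mathfrak n}:(\mathcal O_{\mathbb K}/(\bar d))^\times\to(\mathcal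 O_{\mathbb K}/\mathfrak n)^\times$ be the reduction. Then for each $M$-orbit in $\mathbb Z_{\bar d}^2$ there is exactly one ideal factor $\mathfrak n$ of $\bar d$ such that all points of the orbit have stabilizer $\hat\jmath^{-1}(\ker\pi_{\mathfrak n})$ in $M$; and for each ideal factor $\mathfrak n$ of $\bar d$ there is exactly one such orbit. So $M$-orbits and ideal factors of $\bar d$ are in one-to-one correspondence. (2) *Non-algebraic fiducials.* Suppose that $F$ is of type $z$ and that the fiducial is not algebraic. Then $3\mid\bar d$ and $9\nmid\bar d$, and the same holds with $3$ treated as if it ramified: if $L$ is any quadratic number field in which $3$ ramifies, there is an isomorphism $\hat\jmath=(j',j^\times):M\to(\mathcal O_L/(3))^\times\times(\mathcal O_{\mathbb K}/(\bar d/3))^\times$, where the first component is induced by an isomorphism $j':M_3\to(\mathcal O_L/(3))^\times$ with $j'(cI)=c$ for scalars and the second maps $G$ to $a+bv$ if $G\equiv aI+bF\pmod{\bar d/3}$. For every such isomorphism, the relation "all points of the orbit have stabilizer $\hat\jmath^{-1}(\ker\pi_{\mathfrak a}\times\ker\pi_{\mathfrak b})$" is a one-to-one correspondence between the $M$-orbits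 in $\mathbb Z_{\bar d}^2$ and the pairs $(\mathfrak a,\mathfrak b)$ of an ideal factor $\mathfrak a$ of $3$ in $\mathcal O_L$ and an ideal factor $\mathfrak b$ of $\bar d/3$ in $\mathcal O_{\mathbb K}$. -/

import Mathlib

open scoped Matrix Pointwise NumberField ComplexConjugate

noncomputable section

namespace SIC

/-! ### Displacement operators and overlap phases

Vectors of `ℂ^d` are functions `ZMod d → ℂ`, with the Hermitian form `star w ⬝ᵥ z`. -/

/-- `d̄ = d` for `d` odd and `d̄ = 2d` for `d` even. -/
def dbar (d : ℕ) : ℕ := if Even d then 2 * d else d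

/-- `ι = d̄ / d`. -/
def iota (d : ℕ) : ℕ := if Even d then 2 else 1

/-- The index group `(ℤ/d̄)²` of the overlap phases. -/
abbrev Idx (d : ℕ) : Type := Fin 2 → ZMod (dbar d)

/-- `GL₂(ℤ/d̄)`. -/
abbrev GL2 (d : ℕ) : Type := GL (Fin 2) (ZMod (dbar d))

/-- `ω = exp(2πi/d)`. -/
def omega (d : ℕ) : ℂ := Complex.exp (2 * Real.pi * Complex.I / d)

/-- `τ = -exp(πi/d)`. -/
def tau (d : ℕ) : ℂ := -Complex.exp (Real.pi * Complex.I / d)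

/-- The shift matrix: `(w z)_i = z_{i-1}`. -/
def shiftMat (d : ℕ) : Matrix (ZMod d) (ZMod d) ℂ :=
  Matrix.of fun i j => if i = j + 1 then 1 else 0

/-- The clock matrix `h = diag(1, ω, …, ω^{d-1})`. -/
def clockMat (d : ℕ) : Matrix (ZMod d) (ZMod d) ℂ :=
  Matrix.diagonal fun i => omega d ^ i.val

/-- The displacement operator `D_p = τ^{p₁p₂} w^{p₁} h^{p₂}`. -/
def disp (d : ℕ) [NeZero d] (p : Idx d) : Matrix (ZMod d) (ZMod d) ℂ :=
  tau d ^ ((p 0).val * (p 1).val) • (shiftMat d ^ (p 0).val * clockMat d ^ (p 1).val)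

/-- The overlap map `Φ_z(p) = ⟨z, D_p z⟩`. -/
def overlap (d : ℕ) [NeZero d] (z : ZMod d → ℂ) (p : Idx d) : ℂ :=
  star z ⬝ᵥ (disp d p *ᵥ z)

/-- `|⟨w, z⟩|² / (‖w‖² ‖z‖²)`. -/
def transProb (d : ℕ) [NeZero d] (w z : ZMod d → ℂ) : ℝ :=
  Complex.normSq (star w ⬝ᵥ z) / ((star w ⬝ᵥ w).re * (star z ⬝ᵥ z).re)

/-- `z` is a fiducial vector of a Heisenberg SIC-POVM: it has norm one, and the `d²` points
`[w^a h^b z]` of the orbit are pairwise correctly separated. -/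
def IsFiducial (d : ℕ) [NeZero d] (z : ZMod d → ℂ) : Prop :=
  star z ⬝ᵥ z = 1 ∧
  ∀ a b : ZMod d × ZMod d, a ≠ b →
    transProb d ((shiftMat d ^ a.1.val * clockMat d ^ a.2.val) *ᵥ z)
      ((shiftMat d ^ b.1.val * clockMat d ^ b.2.val) *ᵥ z) = 1 / ((d : ℝ) + 1)

/-- The symmetry group `S = {G ∈ GL₂(ℤ/d̄) : Φ_z ∘ G = Φ_z}`. -/
def symGroup (d : ℕ) [NeZero d] (z : ZMod d → ℂ) : Subgroup (GL2 d) where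
  carrier := {G | ∀ p : Idx d, overlap d z (G.1 *ᵥ p) = overlap d z p}
  one_mem' := by intro p; simp
  mul_mem' := by
    intro A B hA hB p
    have := hA (B.1 *ᵥ p)
    rw [Matrix.mulVec_mulVec] at this
    exact this.trans (hB p)
  inv_mem' := by
    intro A hA p
    have := hA ((A⁻¹).1 *ᵥ p)
    rw [Matrix.mulVec_mulVec, ← Units.val_mul, mul_inv_cancel] at this
    simpa using this.symm

/-! ### Centred and strongly centred fiducials -/

/-- `F` is an element of `S` of order 3 and trace `-1` that comes from a Clifford unitary
`U_{F,0}`, i.e. lies in `SL₂(ℤ/d̄)`. -/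
def IsZaunerElement (d : ℕ) [NeZero d] (z : ZMod d → ℂ) (F : GL2 d) : Prop :=
  F ∈ symGroup d z ∧ orderOf F = 3 ∧ F.1.trace = -1 ∧ F.1.det = 1

/-- A Clifford unitary: it permutes the displacement operators up to scalars. -/
def IsCliffordUnitary (d : ℕ) [NeZero d] (U : Matrix (ZMod d) (ZMod d) ℂ) : Prop :=
  U ∈ Matrix.unitaryGroup (ZMod d) ℂ ∧
  ∀ p : Idx d, ∃ (q : Idx d) (c : ℂ), U * disp d p * star U = c • disp d q

/-- Every Clifford unitary that fixes `[z]` is of the form `U_{G,0}`: it acts on the displacement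
operators by `D_p ↦ D_{Gp}`, without additional phases. -/
def IsDisplacementFree (d : ℕ) [NeZero d] (z : ZMod d → ℂ) : Prop :=
  ∀ U : Matrix (ZMod d) (ZMod d) ℂ, IsCliffordUnitary d U → (∃ c : ℂ, U *ᵥ z = c • z) →
    ∃ G : Matrix.SpecialLinearGroup (Fin 2) (ZMod (dbar d)),
      ∀ p : Idx d, U * disp d p * star U = disp d (G.1 *ᵥ p)

/-- Centred fiducials. -/
def IsCentred (d : ℕ) [NeZero d] (z : ZMod d → ℂ) : Prop :=
  IsFiducial d z ∧ (∃ F, IsZaunerElement d z F) ∧ IsDisplacementFree d z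

/-- `D` is the square-free part of `n`. -/
def IsSquarefreePart (D n : ℕ) : Prop := Squarefree D ∧ ∃ k : ℕ, n = D * k ^ 2

/-- `E₁`, the extension of `K = ℚ(√D)` generated by the overlap phases. -/
def E1 (d : ℕ) [NeZero d] (D : ℕ) (z : ZMod d → ℂ) : IntermediateField ℚ ℂ :=
  IntermediateField.adjoin ℚ ({((Real.sqrt D : ℝ) : ℂ)} ∪ Set.range (overlap d z))

/-- `E`, the extension of `K` generated by `τ` and the components of the projector `z z*`. -/
def EField (d : ℕ) [NeZero d] (D : ℕ) (z : ZMod d → ℂ) : IntermediateField ℚ ℂ :=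
  IntermediateField.adjoin ℚ ({((Real.sqrt D : ℝ) : ℂ), tau d} ∪
    Set.range fun ij : ZMod d × ZMod d => z ij.1 * conj (z ij.2))

/-- Strongly centred fiducials: centred, with `E = E₁(i√d̄)`. -/
def IsStronglyCentred (d : ℕ) [NeZero d] (D : ℕ) (z : ZMod d → ℂ) : Prop :=
  IsCentred d z ∧
  EField d D z = E1 d D z ⊔
    IntermediateField.adjoin ℚ {Complex.I * ((Real.sqrt (dbar d) : ℝ) : ℂ)}

/-! ### The Galois group of the overlap phases and the group `M` -/

/-- The overlap phase `Φ_z(p)` as an element of `E₁`. -/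
def overlapE1 (d : ℕ) [NeZero d] (D : ℕ) (z : ZMod d → ℂ) (p : Idx d) : E1 d D z :=
  ⟨overlap d z p, IntermediateField.subset_adjoin _ _ (Or.inr ⟨p, rfl⟩)⟩

/-- The group of automorphisms of `E₁` over `ℚ` that preserve the set of overlap phases. -/
def galGroup (d : ℕ) [NeZero d] (D : ℕ) (z : ZMod d → ℂ) :
    Subgroup (E1 d D z ≃ₐ[ℚ] E1 d D z) :=
  MulAction.stabilizer (E1 d D z ≃ₐ[ℚ] E1 d D z) (Set.range (overlapE1 d D z))

/-- `M`, the group of all `G ∈ GL₂(ℤ/d̄)` such that `g ∘ Φ_z = Φ_z ∘ G` for some `g` in the Galois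
group of the overlap phases. -/
def galM (d : ℕ) [NeZero d] (D : ℕ) (z : ZMod d → ℂ) : Subgroup (GL2 d) where
  carrier := {G | ∃ g ∈ galGroup d D z,
    ∀ p : Idx d, g (overlapE1 d D z p) = overlapE1 d D z (G.1 *ᵥ p)}
  one_mem' := ⟨1, one_mem _, by intro p; simp⟩
  mul_mem' := by
    rintro A B ⟨g, hg, hA⟩ ⟨k, hk, hB⟩
    refine ⟨g * k, mul_mem hg hk, fun p => ?_⟩
    rw [AlgEquiv.mul_apply, hB, hA, Matrix.mulVec_mulVec, Units.val_mul]
  inv_mem' := by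
    rintro A ⟨g, hg, hA⟩
    refine ⟨g⁻¹, inv_mem hg, fun p => ?_⟩
    have h := hA ((A⁻¹).1 *ᵥ p)
    rw [Matrix.mulVec_mulVec, ← Units.val_mul, mul_inv_cancel, Units.val_one,
      Matrix.one_mulVec] at h
    rw [← h, ← AlgEquiv.mul_apply, inv_mul_cancel, AlgEquiv.one_apply]

/-- `M` is a maximal abelian subgroup of `C`. -/
def IsMaximalAbelianIn {G : Type*} [Group G] (M C : Subgroup G) : Prop :=
  Maximal (fun H : Subgroup G => H ≤ C ∧ ∀ x ∈ H, ∀ y ∈ H, x * y = y * x) M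

/-- The matrix `F_z`. -/
def zaunerMat (n : ℕ) : Matrix.SpecialLinearGroup (Fin 2) (ZMod n) :=
  ⟨!![0, -1; 1, -1], by simp [Matrix.det_fin_two]⟩

/-- `F` is of type `z`, i.e. conjugate to `F_z` in `GL₂(ℤ/d̄)`; otherwise it is of type `a`. -/
def IsTypeZ (d : ℕ) (F : GL2 d) : Prop :=
  IsConj F (zaunerMat (dbar d) : GL2 d)

/-! ### The real quadratic field and its units -/

/-- `K = ℚ(√D)`, as a subfield of `ℝ`; the inclusion is the embedding `∞₁` with `√D > 0`. -/
abbrev quadField (D : ℕ) : IntermediateField ℚ ℝ :=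
  IntermediateField.adjoin ℚ {Real.sqrt D}

/-- `u` is a fundamental unit of `K`, positive under `∞₁`. -/
def IsFundamentalUnit (D : ℕ) (u : (𝓞 (quadField D))ˣ) : Prop :=
  0 < (((u : 𝓞 (quadField D)) : quadField D) : ℝ) ∧
  ∀ v : (𝓞 (quadField D))ˣ, ∃ n : ℤ, v = u ^ n ∨ v = -(u ^ n)

/-- `u_D`, the smallest power of `u` of norm one. -/
def normOneUnit (D : ℕ) (u : (𝓞 (quadField D))ˣ) : (𝓞 (quadField D))ˣ :=
  if Algebra.norm ℚ ((u : 𝓞 (quadField D)) : quadField D) = 1 then u else u ^ 2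

/-- The rational part of `u_D ^ r` (with respect to the basis `1, √D`) is `(d - 1) / 2`. -/
def HasRationalPart (d D : ℕ) (u : (𝓞 (quadField D))ˣ) (r : ℕ) : Prop :=
  ∃ b : ℚ, (((normOneUnit D u ^ r : (𝓞 (quadField D))ˣ) : 𝓞 (quadField D)) : quadField D) =
    (((d : ℝ) - 1) / 2 + b * Real.sqrt D : ℝ)

/-- `u_D ^ (ι r)`. -/
def zaunerUnit (d D : ℕ) (u : (𝓞 (quadField D))ˣ) (r : ℕ) : 𝓞 (quadField D) :=
  ((normOneUnit D u ^ (iota d * r) : (𝓞 (quadField D))ˣ) : 𝓞 (quadField D))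

/-- The quotient ring `R / (n)`. -/
abbrev modN (R : Type*) [CommRing R] (n : ℕ) : Type _ := R ⧸ (Ideal.span {(n : R)})

/-- Ideal factors of `n` in `R`. -/
abbrev IdealFactor (R : Type*) [CommRing R] (n : ℕ) : Type _ :=
  {I : Ideal R // I ∣ Ideal.span {(n : R)}}

/-- The reduction `π_I : (R/(n))ˣ → (R/I)ˣ` for an ideal factor `I` of `n`. -/
def piMap {R : Type*} [CommRing R] {n : ℕ} (I : IdealFactor R n) : (modN R n)ˣ →* (R ⧸ I.1)ˣ :=
  Units.map (Ideal.Quotient.factor (Ideal.le_of_dvd I.2)).toMonoidHom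

/-- A divisor `m` of `n`, as an ideal factor of `n`. -/
def natFactor (R : Type*) [CommRing R] {m n : ℕ} (h : m ∣ n) : IdealFactor R n :=
  ⟨Ideal.span {(m : R)}, by
    obtain ⟨k, rfl⟩ := h
    exact ⟨Ideal.span {(k : R)}, by rw [Ideal.span_singleton_mul_span_singleton]; push_cast; rfl⟩⟩

/-! ### The isomorphism `ĵ` and algebraic fiducials -/

/-- Reduction of matrices modulo a divisor of `d̄`. -/
def reduceGL (d : ℕ) {m : ℕ} (h : m ∣ dbar d) : GL2 d →* GL (Fin 2) (ZMod m) :=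
  Matrix.GeneralLinearGroup.map (ZMod.castHom h (ZMod m))

/-- Let `3 ∣ d̄`. The homomorphism `φ` from `M` to `(R/(3))ˣ × (𝓞_K/(d̄/3))ˣ` is of the form
`(j', j^×)`: its first component is induced by an isomorphism `j'` from the projection `M_3` of `M`
to `GL₂(ℤ/3)` onto `(R/(3))ˣ` that is the obvious map on scalars, and its second component
maps `a I + b F` modulo `d̄/3` to `a + b v` modulo `d̄/3`. -/
def IsSplitMap (d D : ℕ) (M : Subgroup (GL2 d)) (F : GL2 d) (v : 𝓞 (quadField D))
    (h3 : 3 ∣ dbar d) (R : Type*) [CommRing R]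
    (φ : M →* (modN R 3)ˣ × (modN (𝓞 (quadField D)) (dbar d / 3))ˣ) : Prop :=
  (∃ j' : M.map (reduceGL d h3) ≃* (modN R 3)ˣ,
    (∀ (c : ℤ) (G : M.map (reduceGL d h3)),
      G.1.1 = (c : Matrix (Fin 2) (Fin 2) (ZMod 3)) → (j' G : modN R 3) = (c : modN R 3)) ∧
    ∀ G : M, (φ G).1 = j' ⟨reduceGL d h3 G.1, Subgroup.mem_map_of_mem _ G.2⟩) ∧
  ∀ (G : M) (a b : ℤ),
    (reduceGL d (Nat.div_dvd_of_dvd h3) G.1).1 =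
      (a : Matrix (Fin 2) (Fin 2) (ZMod (dbar d / 3))) +
        b • (reduceGL d (Nat.div_dvd_of_dvd h3) F).1 →
    ((φ G).2 : modN (𝓞 (quadField D)) (dbar d / 3)) = Ideal.Quotient.mk _ (a + b * v)

/-- The isomorphism `j` from `M` onto `(𝓞_K/(d̄))ˣ` is the map `ĵ`. For `F` of type `z`, it maps
`a I + b F` to `a + b v`, where `v = u_D^{ιr}`. For `F` of type `a`, it is `(j', j^×)` under
`(𝓞_K/(d̄))ˣ ≅ (𝓞_K/(3))ˣ × (𝓞_K/(d̄/3))ˣ`. -/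
def IsJHat (d D : ℕ) (M : Subgroup (GL2 d)) (F : GL2 d) (v : 𝓞 (quadField D))
    (j : M ≃* (modN (𝓞 (quadField D)) (dbar d))ˣ) : Prop :=
  (IsTypeZ d F ∧ ∀ (G : M) (a b : ℤ),
    G.1.1 = (a : Matrix (Fin 2) (Fin 2) (ZMod (dbar d))) + b • F.1 →
      (j G : modN (𝓞 (quadField D)) (dbar d)) = Ideal.Quotient.mk _ (a + b * v)) ∨
  (¬ IsTypeZ d F ∧ ∃ h3 : 3 ∣ dbar d,
    IsSplitMap d D M F v h3 (𝓞 (quadField D))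
      (((piMap (natFactor (𝓞 (quadField D)) h3)).prod
        (piMap (natFactor (𝓞 (quadField D)) (Nat.div_dvd_of_dvd h3)))).comp j.toMonoidHom))

/-- The fiducial is algebraic: `ĵ` is an isomorphism from `M` onto `(𝓞_K/(d̄))ˣ`. -/
def IsAlgebraicFor (d D : ℕ) (M : Subgroup (GL2 d)) (F : GL2 d) (v : 𝓞 (quadField D)) : Prop :=
  ∃ j : M ≃* (modN (𝓞 (quadField D)) (dbar d))ˣ, IsJHat d D M F v j

/-! ### Orbits and stabilizers -/

/-- The orbit of `p` under `M`. -/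
def orbitOf {d : ℕ} (M : Subgroup (GL2 d)) (p : Idx d) : Set (Idx d) :=
  {q | ∃ G ∈ M, q = G.1 *ᵥ p}

/-- The set of all `M`-orbits in `(ℤ/d̄)²`. -/
def orbits {d : ℕ} (M : Subgroup (GL2 d)) : Set (Set (Idx d)) := Set.range (orbitOf M)

/-- The stabilizer of `p` in `M`. -/
def stab {d : ℕ} (M : Subgroup (GL2 d)) (p : Idx d) : Subgroup M where
  carrier := {G | G.1.1 *ᵥ p = p}
  one_mem' := Matrix.one_mulVec p
  mul_mem' := by
    intro A B (hA : A.1.1 *ᵥ p = p) (hB : B.1.1 *ᵥ p = p)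
    change (A.1.1 * B.1.1) *ᵥ p = p
    rw [← Matrix.mulVec_mulVec, hB, hA]
  inv_mem' := by
    intro A (hA : A.1.1 *ᵥ p = p)
    change (A.1⁻¹).1 *ᵥ p = p
    conv_lhs => rw [← hA]
    rw [Matrix.mulVec_mulVec, ← Units.val_mul, inv_mul_cancel, Units.val_one, Matrix.one_mulVec]

/-- The relation "the points of the orbit `o` have stabilizer `κ n`" is a one-to-one correspondence
between the `M`-orbits and the labels `n`. -/
def IsOrbitCorrespondence {d : ℕ} (M : Subgroup (GL2 d)) {N : Type*} (κ : N → Subgroup M) : Prop :=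
  (∀ o ∈ orbits M, ∃! n : N, ∀ p ∈ o, stab M p = κ n) ∧
  (∀ n : N, ∃! o : Set (Idx d), o ∈ orbits M ∧ ∀ p ∈ o, stab M p = κ n)

end SIC

end

/-! Write `n = d̄`. By Cayley–Hamilton `F² + F + 1 = 0`. The unit `v` satisfies `v² - t v + 1 = 0`
with `t ≡ -1` modulo `n`, so it solves the same equation in `𝓞_K/(n)`. Suppose that `F` has a cyclic
vector and that `1, v` is a basis of `𝓞_K/(n)` over `ℤ/n`. Then `(ℤ/n)[F] ≅ 𝓞_K/(n)`, and `(ℤ/n)²`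
is free of rank one over this ring. Maximality makes `M` the whole centralizer of `F`, that is, the
unit group of this ring. The problem becomes the action of `Aˣ` on a finite principal ideal ring
`A`.

There (`isOrbitCorrespondence_of_equivariant`) the stabilizer of `x` consists of the units congruent
to one modulo the annihilator of `x`. By counting, double annihilators are trivial: every ideal is
an annihilator, and elements with equal annihilators generate the same ideal, hence differ by a
unit. A root of `X² + X + 1` excludes residue fields with two elements, so an ideal is recovered
from the units congruent to one modulo it.

The obstruction is the prime 3, because `X² + X + 1` has discriminant `-3`. Unless 3 divides `n`
exactly, the cyclic vector (`exists_isCyclicVector`) and the basis (`bijective_linComb_mk`) both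
exist. If 3 divides `n` exactly, there are two ways out. In type `z`, an isomorphism `ĵ` itself
forces `1, v` to be a basis (`injective_linComb_of_injective_units`). Otherwise 3 is split off by
the Chinese remainder theorem. Modulo 3, any group of matrices isomorphic to the units of a ring
with nine elements, with `-1` matching `-1`, acts like these units (`exists_equiv_of_card_nine`). In
type `z` the algebra generated by `F` modulo 3 is the ring of dual numbers, which is `𝓞_L/(3)` for
any `L` in which 3 ramifies; this yields the isomorphism in the non-algebraic case
(`exists_isSplitMap`). -/

noncomputable section

namespace SIC

/-! ### Ideals, annihilators and units of finite rings -/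

section FiniteRing

variable {A : Type*} [CommRing A]

theorem isUnit_of_forall_notMem_maximal {a : A} (h : ∀ m : MaximalSpectrum A, a ∉ m.asIdeal) :
    IsUnit a := by
  by_contra ha
  obtain ⟨m, hm, ham⟩ := exists_max_ideal_of_mem_nonunits ha
  exact h ⟨m, hm⟩ ham

theorem card_torsionOf_mul_card_span (x : A) :
    Nat.card (Ideal.torsionOf A A x) * Nat.card (Ideal.span {x} : Ideal A) = Nat.card A := by
  rw [Submodule.card_eq_card_quotient_mul_card (Ideal.torsionOf A A x),
    Nat.card_congr (Ideal.quotTorsionOfEquivSpanSingleton A A x).toEquiv]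

variable [Finite A]

theorem exists_sub_mem_maximalIdeals (x : MaximalSpectrum A → A) :
    ∃ y : A, ∀ m : MaximalSpectrum A, y - x m ∈ m.asIdeal := by
  obtain ⟨y, hy⟩ := Ideal.pi_quotient_surjective
    (I := fun m : MaximalSpectrum A => m.asIdeal)
    (fun m m' h => Ideal.isCoprime_iff_sup_eq.2
      (m.isMaximal.coprime_of_ne m'.isMaximal (fun h' => h (MaximalSpectrum.ext h'))))
    (fun m => Ideal.Quotient.mk _ (x m))
  exact ⟨y, fun m => Ideal.Quotient.eq.1 (hy m)⟩

/-- If no residue field of the finite ring `A` has two elements, an ideal `I` is determined by the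
units that are congruent to one modulo `I`. -/
theorem ideal_le_of_units_congruent {v : A} (hv : v ^ 2 + v + 1 = 0) {I J : Ideal A}
    (h : ∀ u : Aˣ, (u : A) - 1 ∈ I → (u : A) - 1 ∈ J) : I ≤ J := by
  classical
  intro x hx
  by_contra hxJ
  -- The conductor of `x` into `J` is proper, hence inside a maximal ideal `m`. A unit `1 + c e x`
  -- with `c e ∉ m` contradicts the hypothesis.
  let C : Ideal A := Submodule.comap (LinearMap.mulRight A x) J
  have hC : C ≠ ⊤ := by
    intro hC
    have h1 : (1 : A) ∈ C := hC ▸ Submodule.mem_top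
    apply hxJ
    simpa [C] using h1
  obtain ⟨m, hm, hCm⟩ := Ideal.exists_le_maximal C hC
  obtain ⟨e, he⟩ := exists_sub_mem_maximalIdeals (A := A)
    (fun m' => if m'.asIdeal = m then 1 else 0)
  have he1 : e - 1 ∈ m := by simpa using he ⟨m, hm⟩
  have he0 : ∀ m' : MaximalSpectrum A, m'.asIdeal ≠ m → e ∈ m'.asIdeal := by
    intro m' hm'
    simpa [hm'] using he m'
  have h1m : (1 : A) ∉ m := (Ideal.ne_top_iff_one m).1 hm.ne_top
  have hem : e ∉ m := fun h' => h1m (by simpa using m.sub_mem h' he1)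
  -- One of `1, -1, v` works: otherwise `2 ≡ 0` and `v ≡ 1` modulo `m`, so that `0 = v² + v + 1 ≡ 3
  -- ≡ 1`.
  obtain ⟨c, hcm, hc⟩ : ∃ c : A, c ∉ m ∧ 1 + c * (e * x) ∉ m := by
    by_contra! hcon
    have a1 := hcon 1 h1m
    have a2 := hcon (-1) (by simpa using h1m)
    have hvm : v ∉ m := by
      intro hvm
      apply h1m
      have : (1 : A) = (v ^ 2 + v + 1) - (v + 1) * v := by ring
      rw [this, hv, zero_sub]
      exact m.neg_mem (m.mul_mem_left _ hvm)
    have a3 := hcon v hvm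
    apply h1m
    have h2 : (2 : A) ∈ m := by
      have := m.add_mem a1 a2
      ring_nf at this
      exact this
    have h3 : v - 1 ∈ m := by
      have := m.sub_mem (m.mul_mem_left v a1) a3
      have e1 : v - 1 = v * (1 + 1 * (e * x)) - (1 + v * (e * x)) := by ring
      rwa [e1]
    have : (1 : A) = (v ^ 2 + v + 1) - (v + 2) * (v - 1) - 2 := by ring
    rw [this, hv]
    exact m.sub_mem (m.sub_mem m.zero_mem (m.mul_mem_left _ h3)) h2
  have hu : IsUnit (1 + c * (e * x)) := by
    refine isUnit_of_forall_notMem_maximal fun m' h' => ?_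
    by_cases hm' : m'.asIdeal = m
    · exact hc (hm' ▸ h')
    · refine (Ideal.ne_top_iff_one m'.asIdeal).1 m'.isMaximal.ne_top ?_
      have := m'.asIdeal.mul_mem_left (c * x) (he0 m' hm')
      have e1 : (1 : A) = (1 + c * (e * x)) - c * x * e := by ring
      rw [e1]
      exact m'.asIdeal.sub_mem h' this
  obtain ⟨u, hu⟩ := hu
  have h4 := h u (by
    rw [hu, add_sub_cancel_left, ← mul_assoc]
    exact I.mul_mem_left _ hx)
  rw [hu, add_sub_cancel_left, ← mul_assoc] at h4
  have h5 : c * e ∈ C := by simpa [C] using h4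
  rcases hm.isPrime.mem_or_mem (hCm h5) with h6 | h6
  exacts [hcm h6, hem h6]

/-- Finite rings have stable range one. If `y = b x` and `x = a y`, then `(1 - a b) x = 0`, so `b`
may be replaced by `b + t (1 - a b)`; the Chinese remainder theorem supplies a `t` that makes this a
unit. -/
theorem associated_of_dvd_dvd_of_finite {x y : A} (hxy : x ∣ y) (hyx : y ∣ x) :
    ∃ u : Aˣ, u * x = y := by
  classical
  obtain ⟨b, rfl⟩ := hxy
  obtain ⟨a, ha⟩ := hyx
  obtain ⟨t, ht⟩ := exists_sub_mem_maximalIdeals (A := A)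
    (fun m => if b ∈ m.asIdeal then 1 else 0)
  have hu : IsUnit (b + t * (1 - a * b)) := by
    refine isUnit_of_forall_notMem_maximal fun m hm => ?_
    have h1m : (1 : A) ∉ m.asIdeal := (Ideal.ne_top_iff_one _).1 m.isMaximal.ne_top
    by_cases hb : b ∈ m.asIdeal
    · have := ht m
      rw [if_pos hb] at this
      apply h1m
      have e1 : (1 : A) = (b + t * (1 - a * b)) - (1 - t * a) * b - (t - 1) := by ring
      rw [e1]
      exact Ideal.sub_mem _ (Ideal.sub_mem _ hm (Ideal.mul_mem_left _ _ hb)) this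
    · have := ht m
      rw [if_neg hb, sub_zero] at this
      apply hb
      have e1 : b = (b + t * (1 - a * b)) - (1 - a * b) * t := by ring
      rw [e1]
      exact Ideal.sub_mem _ hm (Ideal.mul_mem_left _ _ this)
  obtain ⟨u, hu⟩ := hu
  refine ⟨u, ?_⟩
  rw [hu]
  linear_combination t * ha

/-- One inclusion is `w x = 0`. The sizes agree because the annihilator of an element and the ideal
it generates have orders with product `|A|`, both for `x` and for `w`. -/
theorem torsionOf_eq_span {x w : A} (h : Ideal.torsionOf A A x = Ideal.span {w}) :
    Ideal.torsionOf A A w = Ideal.span {x} := by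
  have hle : (Ideal.span {x} : Ideal A) ≤ Ideal.torsionOf A A w := by
    rw [Ideal.span_singleton_le_iff_mem, Ideal.mem_torsionOf_iff, smul_eq_mul, mul_comm]
    have : w ∈ Ideal.torsionOf A A x := h ▸ Ideal.mem_span_singleton_self w
    simpa [Ideal.mem_torsionOf_iff] using this
  have h1 := card_torsionOf_mul_card_span x
  have h2 := card_torsionOf_mul_card_span w
  rw [h] at h1
  have h3 : Nat.card (Ideal.torsionOf A A w) = Nat.card (Ideal.span {x} : Ideal A) := by
    have h0 : 0 < Nat.card (Ideal.span {w} : Ideal A) := Nat.card_pos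
    rw [← h1, mul_comm] at h2
    exact Nat.eq_of_mul_eq_mul_left h0 h2
  exact (SetLike.coe_injective
    (Set.eq_of_subset_of_ncard_le hle h3.le)).symm

variable [IsPrincipalIdealRing A]

theorem exists_torsionOf_eq (I : Ideal A) : ∃ x : A, Ideal.torsionOf A A x = I := by
  obtain ⟨w, hw⟩ := (IsPrincipalIdealRing.principal I).principal
  obtain ⟨x, hx⟩ := (IsPrincipalIdealRing.principal (Ideal.torsionOf A A w)).principal
  exact ⟨x, (torsionOf_eq_span hx).trans hw.symm⟩

theorem exists_unit_mul_eq_of_torsionOf_eq {x y : A}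
    (h : Ideal.torsionOf A A x = Ideal.torsionOf A A y) : ∃ u : Aˣ, u * x = y := by
  obtain ⟨w, hw⟩ := (IsPrincipalIdealRing.principal (Ideal.torsionOf A A x)).principal
  have h1 := torsionOf_eq_span hw
  have h2 := torsionOf_eq_span (h ▸ hw)
  have h3 : (Ideal.span {x} : Ideal A) = Ideal.span {y} := h1.symm.trans h2
  exact associated_of_dvd_dvd_of_finite
    (Ideal.span_singleton_le_span_singleton.1 h3.ge) (Ideal.span_singleton_le_span_singleton.1 h3.le)

end FiniteRing

/-! ### Orbits of the unit group of a finite principal ideal ring -/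

theorem orbitOf_eq {d : ℕ} {M : Subgroup (GL2 d)} {p : Idx d} {G : GL2 d} (hG : G ∈ M) :
    orbitOf M (G.1 *ᵥ p) = orbitOf M p := by
  ext q
  constructor
  · rintro ⟨H, hH, rfl⟩
    exact ⟨H * G, mul_mem hH hG, by rw [Matrix.mulVec_mulVec, Units.val_mul]⟩
  · rintro ⟨H, hH, rfl⟩
    refine ⟨H * G⁻¹, mul_mem hH (inv_mem hG), ?_⟩
    rw [Matrix.mulVec_mulVec, ← Units.val_mul, inv_mul_cancel_right]

/-- If `M` acts on `(ℤ/d̄)²` as the unit group of a finite principal ideal ring `A` acts on `A`, and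
`A` has no residue field with two elements, then the stabilizers of the orbits correspond to the
ideals of `A`. -/
theorem isOrbitCorrespondence_of_equivariant {d : ℕ} (M : Subgroup (GL2 d)) {A : Type*}
    [CommRing A] [Finite A] [IsPrincipalIdealRing A] {v : A} (hv : v ^ 2 + v + 1 = 0)
    (j : M ≃* Aˣ) (e : Idx d ≃ A) (he : ∀ (G : M) (p : Idx d), e (G.1.1 *ᵥ p) = j G * e p)
    {N : Type*} (f : N → Ideal A) (hf : Function.Bijective f) (κ : N → Subgroup M)
    (hκ : ∀ (n : N) (G : M), G ∈ κ n ↔ (j G : A) - 1 ∈ f n) : IsOrbitCorrespondence M κ := by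
  have hstab : ∀ (p : Idx d) (G : M), G ∈ stab M p ↔ (j G : A) - 1 ∈ Ideal.torsionOf A A (e p) := by
    intro p G
    rw [Ideal.mem_torsionOf_iff, smul_eq_mul, sub_mul, one_mul, sub_eq_zero, ← he]
    exact e.injective.eq_iff.symm
  have hinj : ∀ {I J : Ideal A}, (∀ G : M, (j G : A) - 1 ∈ I ↔ (j G : A) - 1 ∈ J) → I = J := by
    intro I J h
    refine le_antisymm (ideal_le_of_units_congruent hv fun u hu => ?_)
      (ideal_le_of_units_congruent hv fun u hu => ?_)
    · simpa using (h (j.symm u)).1 (by simpa using hu)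
    · simpa using (h (j.symm u)).2 (by simpa using hu)
  have hann : ∀ (p : Idx d) (n : N), stab M p = κ n ↔ Ideal.torsionOf A A (e p) = f n := by
    intro p n
    constructor
    · intro h
      exact hinj fun G => by rw [← hstab, ← hκ, h]
    · intro h
      ext G
      rw [hstab, hκ, h]
  have hunit : ∀ (u : Aˣ) (x : A), Ideal.torsionOf A A (u * x) = Ideal.torsionOf A A x := by
    intro u x
    ext y
    rw [Ideal.mem_torsionOf_iff, Ideal.mem_torsionOf_iff, smul_eq_mul, smul_eq_mul, mul_left_comm,
      Units.mul_right_eq_zero]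
  have horb : ∀ (p : Idx d) (n : N), (∀ q ∈ orbitOf M p, stab M q = κ n) ↔
      Ideal.torsionOf A A (e p) = f n := by
    intro p n
    rw [← hann]
    constructor
    · intro h
      exact h p ⟨1, one_mem _, by simp⟩
    · rintro h q ⟨G, hG, rfl⟩
      rw [hann] at h ⊢
      rw [← h, he ⟨G, hG⟩, hunit]
  constructor
  · rintro _ ⟨p, rfl⟩
    simp_rw [horb]
    obtain ⟨n, hn⟩ := hf.2 (Ideal.torsionOf A A (e p))
    exact ⟨n, hn.symm, fun n' hn' => hf.1 (hn'.symm.trans hn.symm)⟩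
  · intro n
    obtain ⟨x, hx⟩ := exists_torsionOf_eq (f n)
    refine ⟨orbitOf M (e.symm x), ⟨⟨_, rfl⟩, (horb _ _).2 (by simpa using hx)⟩, ?_⟩
    rintro _ ⟨⟨q, rfl⟩, hq⟩
    rw [horb] at hq
    obtain ⟨u, hu⟩ := exists_unit_mul_eq_of_torsionOf_eq (hx.trans hq.symm)
    have hq' : q = (j.symm u).1.1 *ᵥ (e.symm x) := by
      apply e.injective
      rw [he]
      simp [hu]
    rw [hq', orbitOf_eq (j.symm u).2]

/-! ### Real quadratic fields -/

/-- `√D` as an element of `ℚ(√D)`. -/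
def sqrtGen (D : ℕ) : quadField D :=
  ⟨Real.sqrt D, IntermediateField.mem_adjoin_simple_self ℚ _⟩

theorem sqrtGen_mul_self (D : ℕ) : sqrtGen D * sqrtGen D = (D : quadField D) := by
  apply Subtype.ext
  simp [sqrtGen]

/-- The parametrization `p + q ω ↦ p + q √D` of `ℚ(√D)`. -/
def quadHom (D : ℕ) : QuadraticAlgebra ℚ (D : ℚ) 0 →ₐ[ℚ] quadField D :=
  QuadraticAlgebra.lift ⟨sqrtGen D, by
    rw [sqrtGen_mul_self, zero_smul, add_zero, ← Algebra.algebraMap_eq_smul_one, map_natCast]⟩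

theorem coe_quadHom (D : ℕ) (z : QuadraticAlgebra ℚ (D : ℚ) 0) :
    ((quadHom D z : quadField D) : ℝ) = z.re + z.im * Real.sqrt D := by
  simp [quadHom, sqrtGen, Algebra.smul_def]

theorem quadHom_bijective {D : ℕ} (hD : ¬ IsSquare D) : Function.Bijective (quadHom D) := by
  have hirr : Irrational (Real.sqrt D) := irrational_sqrt_natCast_iff.2 hD
  constructor
  · rw [injective_iff_map_eq_zero]
    intro z hz
    have h := coe_quadHom D z
    rw [hz] at h
    have him : z.im = 0 := by
      by_contra him
      apply hirr
      refine ⟨-z.re / z.im, ?_⟩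
      have : (z.im : ℝ) ≠ 0 := by exact_mod_cast him
      push_cast
      rw [div_eq_iff this]
      have h' : (0 : ℝ) = z.re + z.im * Real.sqrt D := h
      linarith
    rw [him] at h
    have hre : z.re = 0 := by simpa using h.symm
    ext
    exacts [hre, him]
  · rintro ⟨x, hx⟩
    have hint : IsAlgebraic ℚ (Real.sqrt D) :=
      (IsIntegral.of_pow (n := 2) (by norm_num) (by
        rw [Real.sq_sqrt (Nat.cast_nonneg _)]
        exact isIntegral_algebraMap (R := ℚ) (x := (D : ℚ)))).isAlgebraic
    have hx' : x ∈ Algebra.adjoin ℚ {Real.sqrt D} := by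
      rw [← IntermediateField.adjoin_simple_toSubalgebra_of_isAlgebraic hint]
      exact hx
    have hle : Algebra.adjoin ℚ {Real.sqrt D} ≤ ((quadField D).val.comp (quadHom D)).range := by
      rw [Algebra.adjoin_le_iff, Set.singleton_subset_iff]
      exact ⟨QuadraticAlgebra.omega, by
        change ((quadHom D _ : quadField D) : ℝ) = _
        rw [coe_quadHom]; simp⟩
    obtain ⟨z, hz⟩ := hle hx'
    exact ⟨z, Subtype.ext hz⟩

/-- `ℚ(√D)` as a quadratic algebra. -/
def quadEquiv {D : ℕ} (hD : ¬ IsSquare D) : QuadraticAlgebra ℚ (D : ℚ) 0 ≃ₐ[ℚ] quadField D :=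
  AlgEquiv.ofBijective (quadHom D) (quadHom_bijective hD)

theorem finrank_quadField {D : ℕ} (hD : ¬ IsSquare D) : Module.finrank ℚ (quadField D) = 2 := by
  rw [← (quadEquiv hD).toLinearEquiv.finrank_eq, QuadraticAlgebra.finrank_eq_two]

theorem numberField_quadField {D : ℕ} (hD : ¬ IsSquare D) : NumberField (quadField D) where
  to_charZero := inferInstance
  to_finiteDimensional := Module.Finite.equiv (quadEquiv hD).toLinearEquiv

theorem norm_quadField {D : ℕ} (hD : ¬ IsSquare D) {x : quadField D} {p q : ℚ}
    (hx : (x : ℝ) = p + q * Real.sqrt D) : Algebra.norm ℚ x = p ^ 2 - D * q ^ 2 := by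
  have h : x = quadEquiv hD ⟨p, q⟩ := Subtype.ext (by
    rw [hx]; exact (coe_quadHom D ⟨p, q⟩).symm)
  rw [h, Algebra.norm_eq_of_algEquiv, Algebra.norm_apply]
  have := QuadraticAlgebra.det_toLinearMap_eq_norm (R := ℚ) (a := (D : ℚ)) (b := 0) ⟨p, q⟩
  refine Eq.trans ?_ (this.trans ?_)
  · rfl
  · simp [QuadraticAlgebra.norm_def]; ring

theorem norm_normOneUnit {D : ℕ} (hD : ¬ IsSquare D) (u : (𝓞 (quadField D))ˣ) :
    Algebra.norm ℚ ((normOneUnit D u : 𝓞 (quadField D)) : quadField D) = 1 := by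
  have := numberField_quadField hD
  unfold normOneUnit
  split_ifs with h
  · exact h
  · have h1 := (NumberField.isUnit_iff_norm (K := quadField D) (x := (u : 𝓞 (quadField D)))).1
      u.isUnit
    rw [RingOfIntegers.coe_norm] at h1
    rw [Units.val_pow_eq_pow_val]
    push_cast
    rw [map_pow, ← sq_abs, h1, one_pow]

/-- The trace of `v = u_D ^ (ι r)`. -/
theorem exists_zaunerUnit_trace {d D : ℕ} (hd : 4 ≤ d) (hD : ¬ IsSquare D)
    (u : (𝓞 (quadField D))ˣ) (r : ℕ) (hr : HasRationalPart d D u r) :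
    ∃ t : ℤ, 3 ≤ t ∧ (dbar d : ℤ) ∣ t + 1 ∧
      (zaunerUnit d D u r) ^ 2 - t * zaunerUnit d D u r + 1 = 0 := by
  set y : 𝓞 (quadField D) := ((normOneUnit D u ^ r : (𝓞 (quadField D))ˣ) : 𝓞 (quadField D)) with hy
  -- The unit `y` has norm one and rational part `(d - 1) / 2`, hence trace `d - 1`.
  have hyq : y ^ 2 - (d - 1) * y + 1 = 0 := by
    obtain ⟨b, hb⟩ := hr
    rw [← hy] at hb
    have hn : Algebra.norm ℚ (y : quadField D) = 1 := by
      rw [hy, Units.val_pow_eq_pow_val]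
      push_cast
      rw [map_pow, norm_normOneUnit hD, one_pow]
    rw [norm_quadField hD (p := ((d : ℚ) - 1) / 2) (q := b) (by rw [hb]; push_cast; ring)] at hn
    have hn' : (((d : ℝ) - 1) / 2) ^ 2 - D * (b : ℝ) ^ 2 = 1 := by exact_mod_cast hn
    apply NumberField.RingOfIntegers.ext
    apply Subtype.ext
    push_cast
    rw [hb]
    have hs := Real.sq_sqrt (Nat.cast_nonneg (α := ℝ) D)
    linear_combination (b : ℝ) ^ 2 * hs - hn'
  have hd' : (4 : ℤ) ≤ d := by exact_mod_cast hd
  by_cases he : Even d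
  -- For even `d` the unit is `y²`, of trace `(d - 1)² - 2`; adding one gives `d (d - 2)`, a
  -- multiple of `2 d`.
  · refine ⟨((d : ℤ) - 1) ^ 2 - 2, by nlinarith, ?_, ?_⟩
    · obtain ⟨k, hk⟩ := he
      refine ⟨k - 1, ?_⟩
      simp only [dbar, if_pos (show Even d from ⟨k, hk⟩)]
      rw [hk]
      push_cast
      ring
    · have : zaunerUnit d D u r = y ^ 2 := by
        rw [zaunerUnit, hy, iota, if_pos he, mul_comm, pow_mul, Units.val_pow_eq_pow_val]
      rw [this]
      push_cast
      linear_combination (y ^ 2 + (d - 1) * y + 1) * hyq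
  · refine ⟨(d : ℤ) - 1, by linarith, ?_, ?_⟩
    · simp [dbar, he]
    · have : zaunerUnit d D u r = y := by
        rw [zaunerUnit, hy, iota, if_neg he, one_mul]
      rw [this]
      push_cast
      linear_combination hyq

/-- `n` is not exactly divisible by `3`. -/
def NotExactlyThree (n : ℕ) : Prop := 3 ∣ n → 9 ∣ n

/-! ### Integrality: when `1, v` is a basis modulo `n` -/

theorem exists_int_quadratic (K : Type*) [Field K] [NumberField K] (hK : Module.finrank ℚ K = 2)
    (w : 𝓞 K) : ∃ T N : ℤ, w ^ 2 - T * w + N = 0 := by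
  have hfin : Module.finrank ℤ (𝓞 K) = 2 := by rw [NumberField.RingOfIntegers.rank, hK]
  let p := (Algebra.lmul ℤ (𝓞 K) w).charpoly
  have hp : p.natDegree = 2 := by rw [LinearMap.charpoly_natDegree, hfin]
  have hm : p.coeff 2 = 1 := hp ▸ (LinearMap.charpoly_monic _)
  have h0 : Polynomial.aeval w p = 0 := by
    have h := LinearMap.aeval_self_charpoly (Algebra.lmul ℤ (𝓞 K) w)
    rw [Polynomial.aeval_algHom_apply] at h
    simpa [p] using congrArg (fun f => f 1) h
  rw [Polynomial.aeval_eq_sum_range, hp] at h0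
  simp only [Finset.sum_range_succ, Finset.sum_range_zero, hm] at h0
  refine ⟨-p.coeff 1, p.coeff 0, ?_⟩
  simp only [zsmul_eq_mul, pow_zero, pow_one] at h0
  push_cast at h0 ⊢
  linear_combination h0

/-- Cancel the gcd of `n` and `b`. The remaining factor `n1` of `n` satisfies `n1² ∣ t² - 4` and `n1
∣ t² - 1`, hence `n1 ∣ 3`. If `n1 = ±3`, then `9 ∣ n`, and 9 divides both numbers and their
difference 3. -/
theorem dvd_of_sq_dvd_sq_mul {n : ℕ} (hn : n ≠ 0) {b t : ℤ} (ht : (n : ℤ) ∣ t + 1)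
    (h3 : NotExactlyThree n) (h : (n : ℤ) ^ 2 ∣ b ^ 2 * (t ^ 2 - 4)) : (n : ℤ) ∣ b := by
  obtain ⟨g, n1, b1, hg, hco, hn1, hb1⟩ : ∃ g n1 b1 : ℤ, g ≠ 0 ∧ IsCoprime n1 b1 ∧
      (n : ℤ) = n1 * g ∧ b = b1 * g := by
    obtain ⟨n1, b1, hco, h1, h2⟩ := Int.exists_gcd_one (m := (n : ℤ)) (n := b)
      (Int.gcd_pos_iff.2 (Or.inl (by exact_mod_cast hn)))
    exact ⟨_, n1, b1, by simp [Int.gcd_eq_zero_iff, hn], Int.isCoprime_iff_gcd_eq_one.2 hco, h1, h2⟩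
  have h1 : n1 ^ 2 ∣ t ^ 2 - 4 := by
    rw [hn1, hb1, mul_pow, mul_pow, mul_right_comm] at h
    exact (hco.pow (m := 2) (n := 2)).dvd_of_dvd_mul_left
      (Int.dvd_of_mul_dvd_mul_right (pow_ne_zero 2 hg) h)
  have h2 : n1 ∣ 3 := by
    have e1 : n1 ∣ (t + 1) * (t - 1) := ((Dvd.intro _ hn1.symm).trans ht).mul_right _
    have e2 := (Dvd.intro_left _ (sq n1).symm).trans h1
    have := dvd_sub e1 e2
    ring_nf at this
    exact this
  have h3' : n1.natAbs ∣ 3 := Int.natAbs_dvd_natAbs.2 h2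
  rcases (Nat.dvd_prime Nat.prime_three).1 h3' with h4 | h4
  · have : IsUnit n1 := Int.isUnit_iff_natAbs_eq.2 h4
    rw [hn1, hb1]
    exact mul_dvd_mul_right (this.dvd) g
  · exfalso
    have hn13 : (3 : ℤ) ∣ n1 := by
      rw [← Int.natAbs_dvd_natAbs, h4]; simp
    have h3n : (3 : ℤ) ∣ n := hn1 ▸ hn13.mul_right g
    have h9 : (9 : ℤ) ∣ n := by exact_mod_cast h3 (by exact_mod_cast h3n)
    have e1 : (9 : ℤ) ∣ (t + 1) * (t - 1) := (h9.trans ht).mul_right _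
    have e2 : (9 : ℤ) ∣ t ^ 2 - 4 := (by simpa using pow_dvd_pow_of_dvd hn13 2 : (9:ℤ) ∣ n1 ^ 2).trans h1
    have := dvd_sub e1 e2
    ring_nf at this
    omega

/-- The quotient `a / n` is a rational root of a monic integral quadratic, so in lowest terms its
denominator divides the square of its numerator. -/
theorem int_dvd_of_dvd_ringOfIntegers {K : Type*} [Field K] [NumberField K]
    (hK : Module.finrank ℚ K = 2) {n : ℕ} (hn : n ≠ 0) {a : ℤ} (h : (n : 𝓞 K) ∣ a) :
    (n : ℤ) ∣ a := by
  obtain ⟨w, hw⟩ := h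
  obtain ⟨T, N, hTN⟩ := exists_int_quadratic K hK w
  have h1 : ((a ^ 2 - n * T * a + n ^ 2 * N : ℤ) : 𝓞 K) = 0 := by
    push_cast
    linear_combination (n : 𝓞 K) ^ 2 * hTN + (a + n * w - n * T) * hw
  have h2 : a ^ 2 - n * T * a + n ^ 2 * N = 0 := by exact_mod_cast h1
  obtain ⟨n1, a1, hco, e1, e2⟩ := Int.exists_gcd_one (m := (n : ℤ)) (n := a)
    (Int.gcd_pos_iff.2 (Or.inl (by exact_mod_cast hn)))
  generalize hg : ((Int.gcd (n : ℤ) a : ℕ) : ℤ) = g at e1 e2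
  have hg0 : g ≠ 0 := by
    rintro rfl
    simp [Int.gcd_eq_zero_iff, hn] at hg
  rw [e1, e2] at h2 ⊢
  have h3 : a1 ^ 2 - n1 * T * a1 + n1 ^ 2 * N = 0 :=
    mul_left_cancel₀ (pow_ne_zero 2 hg0) (by linear_combination h2)
  have h4 : n1 ∣ a1 * a1 := ⟨T * a1 - n1 * N, by linear_combination h3⟩
  exact mul_dvd_mul_right ((Int.isCoprime_iff_gcd_eq_one.2 hco).dvd_of_dvd_mul_left h4) g

/-- Let `a + b v = n w` with `w² - T w + N = 0`. For `b ≠ 0`, comparing discriminants gives `b² (t²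
- 4) = n² (T² - 4 N)`, which forces `n ∣ b`; then `n ∣ a` follows by subtracting. -/
theorem dvd_of_add_mul_mem_span {K : Type*} [Field K] [NumberField K]
    (hK : Module.finrank ℚ K = 2) {v : 𝓞 K} {t : ℤ} (ht3 : 3 ≤ t) (hv : v ^ 2 - t * v + 1 = 0)
    {n : ℕ} (hn : n ≠ 0) (ht : (n : ℤ) ∣ t + 1) (h3 : NotExactlyThree n) {a b : ℤ}
    (h : (a + b * v : 𝓞 K) ∈ Ideal.span {(n : 𝓞 K)}) : (n : ℤ) ∣ a ∧ (n : ℤ) ∣ b := by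
  -- A linear relation between `1` and `v` would make `t² - 4` a square, but it lies strictly
  -- between `(t - 1)²` and `t²` because `t ≥ 3`.
  have hlin : ∀ x y : ℤ, (x + y * v : 𝓞 K) = 0 → x = 0 ∧ y = 0 := by
    intro x y hxy
    have h1 : ((x ^ 2 + t * x * y + y ^ 2 : ℤ) : 𝓞 K) = 0 := by
      push_cast
      linear_combination (x - y * v + t * y) * hxy + (y : 𝓞 K) ^ 2 * hv
    have h2 : x ^ 2 + t * x * y + y ^ 2 = 0 := by exact_mod_cast h1
    by_cases hy : y = 0
    · subst hy
      simpa using h2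
    · exfalso
      have h3 : y ^ 2 * (t ^ 2 - 4) = (2 * x + t * y) ^ 2 := by linear_combination (-4) * h2
      have h4 : IsSquare (t ^ 2 - 4) := by
        obtain ⟨c, hc⟩ := (Int.pow_dvd_pow_iff two_ne_zero).1 (Dvd.intro _ h3)
        rw [hc, mul_pow] at h3
        exact ⟨c, by rw [← sq]; exact mul_left_cancel₀ (pow_ne_zero 2 hy) h3⟩
      obtain ⟨c, hc⟩ := h4
      rcases abs_mul_abs_self c ▸ hc with hc
      have hc0 := abs_nonneg c
      have h5 : |c| < t := by nlinarith
      have h6 : t - 1 ≤ |c| ∨ |c| ≤ t - 2 := by omega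
      rcases h6 with h6 | h6
      · have : |c| = t - 1 := by omega
        rw [this] at hc
        ring_nf at hc
        omega
      · nlinarith
  obtain ⟨w, hw⟩ := Ideal.mem_span_singleton.1 h
  obtain ⟨T, N, hTN⟩ := exists_int_quadratic K hK w
  -- These are the coordinates of `(a + b v)² - n T (a + b v) + n² N = 0` after the substitution `v²
  -- = t v - 1`.
  obtain ⟨h1, h2⟩ := hlin (a ^ 2 - b ^ 2 - n * T * a + n ^ 2 * N)
    (b * (2 * a + t * b - n * T)) (by
      push_cast
      linear_combination (n : 𝓞 K) ^ 2 * hTN + (a + b * v + n * w - n * T) * hw - (b : 𝓞 K) ^ 2 * hv)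
  have hb : (n : ℤ) ∣ b := by
    rcases mul_eq_zero.1 h2 with hb | hb
    · simp [hb]
    · exact dvd_of_sq_dvd_sq_mul hn ht h3
        ⟨T ^ 2 - 4 * N, by linear_combination (t * b - 2 * a + n * T) * hb + 4 * h1⟩
  obtain ⟨b', rfl⟩ := hb
  refine ⟨int_dvd_of_dvd_ringOfIntegers hK hn ⟨w - b' * v, ?_⟩, dvd_mul_right _ _⟩
  push_cast at hw
  linear_combination hw

theorem card_modN {K : Type*} [Field K] [NumberField K] (hK : Module.finrank ℚ K = 2) (n : ℕ) :
    Nat.card (modN (𝓞 K) n) = n ^ 2 := by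
  have h := Ideal.absNorm_span_natCast (S := 𝓞 K) n
  rw [NumberField.RingOfIntegers.rank, hK] at h
  exact h

/-- In a Dedekind domain every ideal that contains `I ≠ 0` has the form `I + (a)`. -/
theorem isPrincipalIdealRing_quotient {R : Type*} [CommRing R] [IsDedekindDomain R] {I : Ideal R}
    (hI : I ≠ ⊥) : IsPrincipalIdealRing (R ⧸ I) where
  principal J := by
    obtain ⟨a, ha⟩ := IsDedekindDomain.exists_sup_span_eq (I := I)
      (J := J.comap (Ideal.Quotient.mk I)) (by
        intro x hx
        rw [Ideal.mem_comap, Ideal.Quotient.eq_zero_iff_mem.2 hx]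
        exact J.zero_mem) hI
    refine ⟨Ideal.Quotient.mk I a, ?_⟩
    rw [← Ideal.map_comap_of_surjective _ Ideal.Quotient.mk_surjective J, ← ha, Ideal.map_sup,
      Ideal.map_quotient_self, bot_sup_eq, Ideal.map_span, Set.image_singleton]

/-! ### Matrices with a cyclic vector -/

section Cyclic

variable {R : Type*} [CommRing R]

/-- `p` is a cyclic vector of `F`: the vectors `p`, `F p` form a basis. -/
def IsCyclicVector (F : Matrix (Fin 2) (Fin 2) R) (p : Fin 2 → R) : Prop :=
  Function.Bijective fun c : R × R => c.1 • p + c.2 • (F *ᵥ p)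

variable {F : Matrix (Fin 2) (Fin 2) R} {p : Fin 2 → R}

/-- Commuting with `F`, a matrix is known at `F p` once it is known at `p`, and these two vectors
span. -/
theorem IsCyclicVector.matrix_ext (hp : IsCyclicVector F p) {G H : Matrix (Fin 2) (Fin 2) R}
    (hG : G * F = F * G) (hH : H * F = F * H) (h : G *ᵥ p = H *ᵥ p) : G = H := by
  refine Matrix.ext_of_mulVec_single fun i => ?_
  obtain ⟨c, hc⟩ := hp.2 (Pi.single i 1)
  simp only [← hc, Matrix.mulVec_add, Matrix.mulVec_smul, Matrix.mulVec_mulVec, hG, hH]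
  simp only [← Matrix.mulVec_mulVec, h]

theorem commute_smul_one_add_smul (F : Matrix (Fin 2) (Fin 2) R) (a b : R) :
    (a • (1 : Matrix (Fin 2) (Fin 2) R) + b • F) * F = F * (a • 1 + b • F) := by
  simp [add_mul, mul_add]

theorem smul_one_add_smul_mulVec (F : Matrix (Fin 2) (Fin 2) R) (a b : R) (p : Fin 2 → R) :
    (a • (1 : Matrix (Fin 2) (Fin 2) R) + b • F) *ᵥ p = a • p + b • (F *ᵥ p) := by
  simp [Matrix.add_mulVec, Matrix.smul_mulVec]

theorem IsCyclicVector.exists_eq (hp : IsCyclicVector F p) {G : Matrix (Fin 2) (Fin 2) R}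
    (hG : G * F = F * G) : ∃ a b : R, G = a • (1 : Matrix (Fin 2) (Fin 2) R) + b • F := by
  obtain ⟨c, hc⟩ := hp.2 (G *ᵥ p)
  exact ⟨c.1, c.2, hp.matrix_ext hG (commute_smul_one_add_smul F _ _)
    (by rw [smul_one_add_smul_mulVec]; exact hc.symm)⟩

theorem IsCyclicVector.coeff_unique (hp : IsCyclicVector F p) {a b a' b' : R}
    (h : a • (1 : Matrix (Fin 2) (Fin 2) R) + b • F = a' • 1 + b' • F) : a = a' ∧ b = b' := by
  have h1 := congrArg (fun X => X *ᵥ p) h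
  simp only [smul_one_add_smul_mulVec] at h1
  exact Prod.mk.inj (@hp.1 (a, b) (a', b') h1)

theorem sq_add_self_add_one (htr : F.trace = -1) (hdet : F.det = 1) : F * F + F + 1 = 0 := by
  rw [Matrix.trace_fin_two] at htr
  rw [Matrix.det_fin_two] at hdet
  ext i j
  fin_cases i <;> fin_cases j <;> simp [Matrix.mul_apply, Fin.sum_univ_two]
  · linear_combination F 0 0 * htr - hdet
  · linear_combination F 0 1 * htr
  · linear_combination F 1 0 * htr
  · linear_combination F 1 1 * htr - hdet

/-- The vector `p` is cyclic if `det (p, F p)` is a unit. -/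
theorem isCyclicVector_of_isUnit
    (h : IsUnit (p 0 * (F *ᵥ p) 1 - p 1 * (F *ᵥ p) 0)) : IsCyclicVector F p := by
  obtain ⟨u, hu⟩ := h
  set q := F *ᵥ p with hq
  have huv : (↑u⁻¹ : R) * (p 0 * q 1 - p 1 * q 0) = 1 := by rw [← hu]; simp
  constructor
  · rintro ⟨a, b⟩ ⟨a', b'⟩ h
    have h0 := congrFun h 0
    have h1 := congrFun h 1
    simp only [Pi.add_apply, Pi.smul_apply, smul_eq_mul, ← hq] at h0 h1
    refine Prod.ext ?_ ?_
    · simp only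
      linear_combination (a' - a) * huv + (↑u⁻¹ : R) * (q 1 * h0 - q 0 * h1)
    · simp only
      linear_combination (b' - b) * huv + (↑u⁻¹ : R) * (p 0 * h1 - p 1 * h0)
  · intro x
    refine ⟨((↑u⁻¹ : R) * (q 1 * x 0 - q 0 * x 1), (↑u⁻¹ : R) * (p 0 * x 1 - p 1 * x 0)), ?_⟩
    change (_ : R) • p + (_ : R) • q = x
    ext i
    fin_cases i
    · simp
      linear_combination x 0 * huv
    · simp
      linear_combination x 1 * huv

/-- In the basis `p, F p` the matrix of `F` is `F_z`, because `F² p = -p - F p`. -/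
theorem IsCyclicVector.isConj {n : ℕ} {F : GL (Fin 2) (ZMod n)} {p : Fin 2 → ZMod n}
    (hp : IsCyclicVector F.1 p) (hF : F.1 * F.1 + F.1 + 1 = 0) :
    IsConj F (zaunerMat n : GL (Fin 2) (ZMod n)) := by
  let P : Matrix (Fin 2) (Fin 2) (ZMod n) := !![p 0, (F.1 *ᵥ p) 0; p 1, (F.1 *ᵥ p) 1]
  have hP : ∀ x : Fin 2 → ZMod n, P *ᵥ x = x 0 • p + x 1 • (F.1 *ᵥ p) := by
    intro x
    ext i
    fin_cases i <;> simp [P, Matrix.mulVec, dotProduct, Fin.sum_univ_two] <;> ring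
  have hPu : IsUnit P := by
    rw [← Matrix.mulVec_surjective_iff_isUnit]
    intro y
    obtain ⟨c, hc⟩ := hp.2 y
    exact ⟨![c.1, c.2], by rw [hP]; simpa using hc⟩
  obtain ⟨P', hP'⟩ := hPu
  refine IsConj.symm (isConj_iff.2 ⟨P', ?_⟩)
  rw [mul_inv_eq_iff_eq_mul]
  apply Units.ext
  rw [Units.val_mul, Units.val_mul, hP']
  have hFp : F.1 *ᵥ (F.1 *ᵥ p) = -p - F.1 *ᵥ p := by
    have h := congrArg (fun X => X *ᵥ p) hF
    simp only [Matrix.add_mulVec, ← Matrix.mulVec_mulVec, Matrix.one_mulVec, Matrix.zero_mulVec] at h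
    linear_combination h
  refine Matrix.ext_of_mulVec_single fun i => ?_
  rw [← Matrix.mulVec_mulVec, ← Matrix.mulVec_mulVec, hP, hP]
  have e : (zaunerMat n : GL (Fin 2) (ZMod n)).1 = !![0, -1; 1, -1] := rfl
  rw [e, Matrix.mulVec_add, Matrix.mulVec_smul, Matrix.mulVec_smul, hFp]
  generalize F.1 *ᵥ p = q
  ext k
  fin_cases i <;> simp [Matrix.mulVec, dotProduct, Fin.sum_univ_two] <;> ring

theorem exists_isCyclicVector_of_isConj {n : ℕ} {F : GL (Fin 2) (ZMod n)}
    (h : IsConj F (zaunerMat n : GL (Fin 2) (ZMod n))) : ∃ p, IsCyclicVector F.1 p := by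
  obtain ⟨c, hc⟩ := isConj_iff.1 h.symm
  have e : (zaunerMat n : GL (Fin 2) (ZMod n)).1 = !![0, -1; 1, -1] := rfl
  have hF : F.1 * c.1 = c.1 * !![0, -1; 1, -1] := by
    rw [← e, ← Units.val_mul, ← Units.val_mul, ← hc, inv_mul_cancel_right]
  have key : (fun x : ZMod n × ZMod n => x.1 • (c.1 *ᵥ ![1, 0]) +
      x.2 • (F.1 *ᵥ (c.1 *ᵥ ![1, 0]))) = fun x => c.1 *ᵥ ![x.1, x.2] := by
    ext1 x
    rw [Matrix.mulVec_mulVec, hF, ← Matrix.mulVec_mulVec, ← Matrix.mulVec_smul,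
      ← Matrix.mulVec_smul, ← Matrix.mulVec_add]
    congr 1
    ext i
    fin_cases i <;> simp
  refine ⟨c.1 *ᵥ ![1, 0], ?_⟩
  unfold IsCyclicVector
  rw [key]
  constructor
  · intro x y hxy
    have h1 := congrArg (fun z => (c⁻¹).1 *ᵥ z) hxy
    simp only [Matrix.mulVec_mulVec, ← Units.val_mul, inv_mul_cancel, Units.val_one,
      Matrix.one_mulVec] at h1
    exact Prod.ext (by simpa using congrFun h1 0) (by simpa using congrFun h1 1)
  · intro y
    refine ⟨(((c⁻¹).1 *ᵥ y) 0, ((c⁻¹).1 *ᵥ y) 1), ?_⟩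
    have : ![((c⁻¹).1 *ᵥ y) 0, ((c⁻¹).1 *ᵥ y) 1] = (c⁻¹).1 *ᵥ y := by
      ext i; fin_cases i <;> rfl
    simp only [this]
    rw [Matrix.mulVec_mulVec, ← Units.val_mul, mul_inv_cancel, Units.val_one, Matrix.one_mulVec]

/-- A matrix modulo `n` of trace `-1` and determinant `1` has a cyclic vector, unless `n` is exactly
divisible by `3`. -/
theorem exists_isCyclicVector {n : ℕ} (hn : n ≠ 0) (h3 : NotExactlyThree n)
    {F : Matrix (Fin 2) (Fin 2) (ZMod n)} (htr : F.trace = -1) (hdet : F.det = 1) :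
    ∃ p, IsCyclicVector F p := by
  have : NeZero n := ⟨hn⟩
  rw [Matrix.trace_fin_two] at htr
  rw [Matrix.det_fin_two] at hdet
  -- This is `det (p, F p)` at `p = (x, y)`, a binary form of discriminant `tr² - 4 det = -3`. By
  -- the Chinese remainder theorem a nonzero value modulo each maximal ideal suffices.
  let Q : ZMod n → ZMod n → ZMod n := fun x y =>
    F 1 0 * x ^ 2 + (F 1 1 - F 0 0) * x * y - F 0 1 * y ^ 2
  have hloc : ∀ m : MaximalSpectrum (ZMod n), ∃ xy : ZMod n × ZMod n,
      Q xy.1 xy.2 ∉ m.asIdeal := by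
    intro m
    by_contra! hcon
    have a1 : F 1 0 ∈ m.asIdeal := by simpa [Q] using hcon (1, 0)
    have a2 : F 0 1 ∈ m.asIdeal := by simpa [Q] using hcon (0, 1)
    have a3 : F 1 1 - F 0 0 ∈ m.asIdeal := by
      have h := hcon (1, 1)
      have e : F 1 1 - F 0 0 = Q 1 1 - F 1 0 + F 0 1 := by simp only [Q]; ring
      rw [e]
      exact Ideal.add_mem _ (Ideal.sub_mem _ h a1) a2
    have h1m : (1 : ZMod n) ∉ m.asIdeal := (Ideal.ne_top_iff_one _).1 m.isMaximal.ne_top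
    have hdisc : (F 1 1 - F 0 0) * (F 1 1 - F 0 0) + 4 * F 0 1 * F 1 0 + 3 = 0 := by
      linear_combination (F 0 0 + F 1 1 - 1) * htr - 4 * hdet
    have h3m : (3 : ZMod n) ∈ m.asIdeal := by
      have e : (3 : ZMod n) = 0 - (F 1 1 - F 0 0) * (F 1 1 - F 0 0) - (4 * F 0 1) * F 1 0 := by
        rw [← hdisc]; ring
      rw [e]
      exact Ideal.sub_mem _ (Ideal.sub_mem _ (Ideal.zero_mem _) (Ideal.mul_mem_left _ _ a3))
        (Ideal.mul_mem_left _ _ a1)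
    have h3n : 3 ∣ n := by
      by_contra h
      have hco : IsCoprime (3 : ℤ) n := by
        exact Nat.isCoprime_iff_coprime.2 ((Nat.Prime.coprime_iff_not_dvd Nat.prime_three).2 h)
      obtain ⟨x, y, hxy⟩ := hco
      apply h1m
      have h4 := congrArg (Int.cast (R := ZMod n)) hxy
      push_cast at h4
      rw [ZMod.natCast_self, mul_zero, add_zero] at h4
      rw [← h4]
      exact Ideal.mul_mem_left _ _ h3m
    -- A form that vanishes at all points modulo `m` has its coefficients in `m`, where they are
    -- multiples of 3. The discriminant `-3` would then be zero modulo 9.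
    have h9 := h3 h3n
    have hmem : ∀ x : ZMod n, x ∈ m.asIdeal → ∃ y, x = 3 * y := by
      intro x hx
      by_contra! hcon'
      have hx3 : ¬ (3 : ℤ) ∣ x.val := by
        rintro ⟨k, hk⟩
        apply hcon' k
        have h4 := congrArg (Int.cast (R := ZMod n)) hk
        push_cast at h4
        rwa [ZMod.natCast_zmod_val] at h4
      obtain ⟨s, t, hst⟩ := (Int.prime_three.coprime_iff_not_dvd).2 hx3
      apply h1m
      have h4 := congrArg (Int.cast (R := ZMod n)) hst
      push_cast at h4
      rw [ZMod.natCast_zmod_val] at h4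
      rw [← h4]
      exact Ideal.add_mem _ (Ideal.mul_mem_left _ _ h3m) (Ideal.mul_mem_left _ _ hx)
    obtain ⟨x1, e1⟩ := hmem _ a1
    obtain ⟨x2, e2⟩ := hmem _ a2
    obtain ⟨x3, e3⟩ := hmem _ a3
    rw [e1, e2, e3] at hdisc
    have h5 := congrArg (ZMod.castHom h9 (ZMod 9)) hdisc
    simp only [map_add, map_mul, map_ofNat, map_zero] at h5
    revert h5
    generalize ZMod.castHom h9 (ZMod 9) x1 = y1
    generalize ZMod.castHom h9 (ZMod 9) x2 = y2
    generalize ZMod.castHom h9 (ZMod 9) x3 = y3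
    have e9 : (9 : ZMod 9) = 0 := rfl
    intro h5
    have : (3 : ZMod 9) = 0 := by
      linear_combination h5 - (y3 * y3 + 4 * y2 * y1) * e9
    exact absurd this (by decide)
  choose xy hxy using hloc
  obtain ⟨x, hx⟩ := exists_sub_mem_maximalIdeals fun m => (xy m).1
  obtain ⟨y, hy⟩ := exists_sub_mem_maximalIdeals fun m => (xy m).2
  refine ⟨![x, y], isCyclicVector_of_isUnit (isUnit_of_forall_notMem_maximal fun m hm => hxy m ?_)⟩
  have e : Q (xy m).1 (xy m).2 = (![x, y] 0 * (F *ᵥ ![x, y]) 1 - ![x, y] 1 * (F *ᵥ ![x, y]) 0) -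
      (F 1 0 * (x + (xy m).1) + (F 1 1 - F 0 0) * y) * (x - (xy m).1) -
      ((F 1 1 - F 0 0) * (xy m).1 - F 0 1 * (y + (xy m).2)) * (y - (xy m).2) := by
    simp [Q, Matrix.mulVec, dotProduct, Fin.sum_univ_two]
    ring
  rw [e]
  exact Ideal.sub_mem _ (Ideal.sub_mem _ hm (Ideal.mul_mem_left _ _ (hx m)))
    (Ideal.mul_mem_left _ _ (hy m))

end Cyclic

/-- The map `(a, b) ↦ a + b s` from `R²` to an `R`-algebra. -/
def linComb (R : Type*) {A : Type*} [CommRing R] [CommRing A] [Algebra R A] (s : A) (c : R × R) :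
    A :=
  algebraMap R A c.1 + algebraMap R A c.2 * s

/-- Since `X` and `s` satisfy the same quadratic relation, `a p₀ + b X p₀ ↦ a + b s` turns the
action of `X` into multiplication by `s`. -/
theorem exists_equiv_of_isCyclicVector {R A : Type*} [CommRing R] [CommRing A] [Algebra R A]
    {X : Matrix (Fin 2) (Fin 2) R} {p₀ : Fin 2 → R} (hp : IsCyclicVector X p₀) {s : A} {γ δ : R}
    (hX : X * X = γ • (1 : Matrix (Fin 2) (Fin 2) R) + δ • X)
    (hs : s * s = algebraMap R A γ + algebraMap R A δ * s)
    (hb : Function.Bijective (linComb R s)) :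
    ∃ e : (Fin 2 → R) ≃ A, ∀ (a b : R) (p : Fin 2 → R),
      e ((a • (1 : Matrix (Fin 2) (Fin 2) R) + b • X) *ᵥ p) = linComb R s (a, b) * e p := by
  let e₁ : R × R ≃ (Fin 2 → R) := Equiv.ofBijective _ hp
  let e₂ : R × R ≃ A := Equiv.ofBijective _ hb
  refine ⟨e₁.symm.trans e₂, fun a b p => ?_⟩
  obtain ⟨⟨c, c'⟩, rfl⟩ := e₁.surjective p
  have hXX : X *ᵥ (X *ᵥ p₀) = γ • p₀ + δ • (X *ᵥ p₀) := by
    rw [Matrix.mulVec_mulVec, hX, smul_one_add_smul_mulVec]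
  have h1 : (a • (1 : Matrix (Fin 2) (Fin 2) R) + b • X) *ᵥ e₁ (c, c') =
      e₁ (a * c + γ * b * c', a * c' + b * c + δ * b * c') := by
    change _ *ᵥ (c • p₀ + c' • (X *ᵥ p₀)) = (_ : R) • p₀ + (_ : R) • (X *ᵥ p₀)
    rw [smul_one_add_smul_mulVec, Matrix.mulVec_add, Matrix.mulVec_smul, Matrix.mulVec_smul, hXX]
    module
  rw [h1]
  simp only [Equiv.trans_apply, Equiv.symm_apply_apply]
  change linComb R s _ = _ * linComb R s _
  simp only [linComb, map_add, map_mul]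
  linear_combination (-algebraMap R A b * algebraMap R A c') * hs

/-- If `(1, 0)`, `(0, 1)` and `(1, 1)` are all eigenvectors, the matrix is scalar. -/
theorem exists_isCyclicVector_of_ne_smul_one {k : Type*} [Field k] {X : Matrix (Fin 2) (Fin 2) k}
    (hX : ∀ c : k, X ≠ c • (1 : Matrix (Fin 2) (Fin 2) k)) : ∃ p, IsCyclicVector X p := by
  by_contra! hcon
  have h : ∀ p : Fin 2 → k, p 0 * (X *ᵥ p) 1 - p 1 * (X *ᵥ p) 0 = 0 := by
    intro p
    by_contra hp
    exact hcon p (isCyclicVector_of_isUnit (isUnit_iff_ne_zero.2 hp))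
  have h1 := h ![1, 0]
  have h2 := h ![0, 1]
  have h3 := h ![1, 1]
  simp [Matrix.mulVec, dotProduct, Fin.sum_univ_two] at h1 h2 h3
  rw [h1, h2] at h3
  apply hX (X 0 0)
  ext i j
  fin_cases i <;> fin_cases j <;> simp [h1, h2]
  linear_combination h3

/-! ### Rings with nine elements and matrices modulo 3 -/

section ModThree

variable {A : Type*} [CommRing A]

theorem exists_generator_of_card_nine [Algebra (ZMod 3) A] (hA : Nat.card A = 9) :
    ∃ (s : A) (δ : ZMod 3), s * s = algebraMap (ZMod 3) A δ ∧
      Function.Bijective (linComb (ZMod 3) s) := by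
  have hfin : Finite A := Nat.finite_of_card_ne_zero (by rw [hA]; norm_num)
  have hnt : Nontrivial A := by
    rw [← Finite.one_lt_card_iff_nontrivial, hA]; norm_num
  have hinj : Function.Injective (algebraMap (ZMod 3) A) := (algebraMap (ZMod 3) A).injective
  have key : ∀ t : A, (∀ c : ZMod 3, algebraMap (ZMod 3) A c ≠ t) →
      Function.Bijective (linComb (ZMod 3) t) := by
    intro t ht
    refine (Nat.bijective_iff_injective_and_card _).2 ⟨?_, by simp [hA]⟩
    rintro ⟨a, b⟩ ⟨a', b'⟩ h
    simp only [linComb] at h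
    have hb : b = b' := by
      by_contra hb
      have hb' : b - b' ≠ 0 := sub_ne_zero.2 hb
      apply ht ((a' - a) * (b - b')⁻¹)
      have h1 : algebraMap (ZMod 3) A (b - b') * algebraMap (ZMod 3) A (b - b')⁻¹ = 1 := by
        rw [← map_mul, mul_inv_cancel₀ hb', map_one]
      rw [map_mul]
      generalize algebraMap (ZMod 3) A (b - b')⁻¹ = i at h1 ⊢
      rw [map_sub] at h1 ⊢
      linear_combination t * h1 - i * h
    subst hb
    exact Prod.ext (hinj (add_right_cancel h)) rfl
  obtain ⟨t, ht⟩ : ∃ t : A, ∀ c : ZMod 3, algebraMap (ZMod 3) A c ≠ t := by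
    by_contra! hcon
    have := Nat.card_le_card_of_surjective (algebraMap (ZMod 3) A) hcon
    rw [hA, Nat.card_zmod] at this
    omega
  obtain ⟨⟨α, β⟩, hαβ⟩ := (key t ht).2 (t * t)
  simp only [linComb] at hαβ
  have h3 : (3 : A) = 0 := by
    have := map_ofNat (algebraMap (ZMod 3) A) 3
    rw [← this, show (OfNat.ofNat 3 : ZMod 3) = 0 from rfl, map_zero]
  -- Completing the square in `t² = α + β t`: in characteristic three, `-β/2 = β`.
  refine ⟨t + algebraMap (ZMod 3) A β, α + β * β, ?_, key _ fun c hc => ht (c - β) ?_⟩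
  · rw [map_add, map_mul]
    linear_combination -hαβ + algebraMap (ZMod 3) A β * t * h3
  · rw [map_sub, hc, add_sub_cancel_right]

/-- The case in which `g` is the restriction of the linear map `a + b s ↦ a + b X`: a cyclic vector
of the non-scalar matrix `X` identifies the plane with `A`. -/
theorem exists_equiv_of_map_units_linComb [Algebra (ZMod 3) A] {s : A} {δ : ZMod 3}
    (hs : s * s = algebraMap (ZMod 3) A δ) (hb : Function.Bijective (linComb (ZMod 3) s))
    (g : Aˣ → Matrix (Fin 2) (Fin 2) (ZMod 3)) {X : Matrix (Fin 2) (Fin 2) (ZMod 3)}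
    (hX : X * X = δ • (1 : Matrix (Fin 2) (Fin 2) (ZMod 3)))
    (hX' : ∀ c : ZMod 3, X ≠ c • (1 : Matrix (Fin 2) (Fin 2) (ZMod 3)))
    (hg : ∀ (u : Aˣ) (a b : ZMod 3), (u : A) = linComb (ZMod 3) s (a, b) →
      g u = a • (1 : Matrix (Fin 2) (Fin 2) (ZMod 3)) + b • X) :
    ∃ e : (Fin 2 → ZMod 3) ≃ A, ∀ (u : Aˣ) (p : Fin 2 → ZMod 3), e (g u *ᵥ p) = u * e p := by
  obtain ⟨p₀, hp₀⟩ := exists_isCyclicVector_of_ne_smul_one hX'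
  obtain ⟨e, he⟩ := exists_equiv_of_isCyclicVector (γ := δ) (δ := 0) hp₀ (by simpa using hX)
    (by simpa using hs) hb
  refine ⟨e, fun u p => ?_⟩
  obtain ⟨⟨a, b⟩, hab⟩ := hb.2 u
  rw [hg u a b hab.symm, he, hab]

/-- The determinant vanishes, so Cayley–Hamilton gives `X² = (tr X) X` and `0 = X³ = (tr X)² X`. -/
theorem mul_self_eq_zero_of_pow_three {k : Type*} [Field k] {X : Matrix (Fin 2) (Fin 2) k}
    (hX : X * X * X = 0) : X * X = 0 := by
  have hch : X * X = X.trace • X - X.det • (1 : Matrix (Fin 2) (Fin 2) k) := by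
    rw [Matrix.trace_fin_two, Matrix.det_fin_two]
    ext i j
    fin_cases i <;> fin_cases j <;> simp [Matrix.mul_apply, Fin.sum_univ_two] <;> ring
  have hdet : X.det = 0 := by
    have h := congrArg Matrix.det hX
    rw [Matrix.det_mul, Matrix.det_mul, Matrix.det_zero] at h
    simpa using h
  rw [hdet, zero_smul, sub_zero] at hch
  have h1 : (X.trace * X.trace) • X = 0 := by
    rw [mul_smul, ← hch, ← smul_mul_assoc, ← hch, hX]
  rcases smul_eq_zero.1 h1 with h2 | h2
  · rw [hch, mul_self_eq_zero.1 h2, zero_smul]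
  · rw [h2, mul_zero]

variable [Algebra (ZMod 3) A] {s : A} (g : Aˣ →* Matrix (Fin 2) (Fin 2) (ZMod 3))

/-- Dual numbers. The units are generated by `-1` and `1 + s`, the latter of order three. With `X =
g (1 + s) - 1`, characteristic three gives `X³ = g (1 + s)³ - 1 = 0`, hence `X² = 0`, and `g` is
linear on units. Injectivity of `g` makes `X` nonzero. -/
theorem exists_equiv_of_sq_eq_zero (hg : Function.Injective g) (hneg : g (-1) = -1)
    (hs : s * s = 0) (hb : Function.Bijective (linComb (ZMod 3) s)) :
    ∃ e : (Fin 2 → ZMod 3) ≃ A, ∀ (u : Aˣ) (p : Fin 2 → ZMod 3), e (g u *ᵥ p) = u * e p := by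
  have h3 : (3 : A) = 0 := by
    rw [← map_ofNat (algebraMap (ZMod 3) A) 3, show (OfNat.ofNat 3 : ZMod 3) = 0 from rfl, map_zero]
  have hneg' : ∀ u, g (-u) = -g u := fun u => by
    rw [← neg_one_mul, map_mul, hneg, neg_one_mul]
  have hs0 : s ≠ 0 := by
    intro h
    have := @hb.1 (0, 1) (0, 0) (by simp [linComb, h])
    simp at this
  have hnt : Nontrivial A := ⟨s, 0, hs0⟩
  let u₀ : Aˣ := ⟨1 + s, 1 - s, by linear_combination -hs, by linear_combination -hs⟩
  have hu₀ : (u₀ : A) = 1 + s := rfl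
  have hcube : u₀ * u₀ * u₀ = 1 := by
    apply Units.ext
    push_cast
    rw [hu₀]
    linear_combination (s + 3) * hs + s * h3
  set X := g u₀ - 1 with hXdef
  have hgu : g u₀ = 1 + X := by rw [hXdef]; abel
  have hM3 : (3 : Matrix (Fin 2) (Fin 2) (ZMod 3)) = 0 := by decide
  have hXX : X * X = 0 := by
    apply mul_self_eq_zero_of_pow_three
    have h := congrArg g hcube
    rw [map_mul, map_mul, map_one, hgu] at h
    have e : X * X * X = (1 + X) * (1 + X) * (1 + X) - 1 - 3 * (X + X * X) := by noncomm_ring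
    rw [e, h, hM3]
    simp
  refine exists_equiv_of_map_units_linComb (δ := 0) (by simpa using hs) hb g (X := X)
    (by simpa using hXX) ?_ ?_
  · intro c hc
    have hc0 : c = 0 := by
      rw [hc] at hXX
      simpa using congrFun (congrFun hXX 0) 0
    rw [hc0, zero_smul] at hc
    rw [hc, add_zero, ← map_one g] at hgu
    have := congrArg Units.val (hg hgu)
    rw [hu₀] at this
    exact hs0 (by simpa using this)
  · intro u a b hu
    have hsq : g (u₀ * u₀) = 1 + 2 * X := by
      rw [map_mul, hgu]
      have e : (1 + X) * (1 + X) = 1 + 2 * X + X * X := by noncomm_ring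
      rw [e, hXX, add_zero]
    have htwo : (2 : Matrix (Fin 2) (Fin 2) (ZMod 3)) = -1 := by decide
    have ha : a ≠ 0 := by
      rintro rfl
      have : (u : A) * u = 0 := by
        rw [hu]
        simp only [linComb, map_zero, zero_add]
        linear_combination (algebraMap (ZMod 3) A b) ^ 2 * hs
      simp at this
    have hcases : ∀ c : ZMod 3, c = 0 ∨ c = 1 ∨ c = -1 := by decide
    have huu : ((u₀ * u₀ : Aˣ) : A) = 1 - s := by
      push_cast
      rw [hu₀]
      linear_combination hs + s * h3
    rcases hcases a with rfl | rfl | rfl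
    · exact absurd rfl ha
    · rcases hcases b with rfl | rfl | rfl
      · have : u = 1 := Units.ext (by rw [hu]; simp [linComb])
        rw [this]; simp
      · have : u = u₀ := Units.ext (by rw [hu, hu₀]; simp [linComb])
        rw [this, hgu]; simp
      · have : u = u₀ * u₀ := Units.ext (by rw [hu, huu]; simp [linComb, sub_eq_add_neg])
        rw [this, hsq, htwo]; simp
    · rcases hcases b with rfl | rfl | rfl
      · have : u = -1 := Units.ext (by rw [hu]; simp [linComb])
        rw [this, hneg]; simp
      · have : u = -(u₀ * u₀) := Units.ext (by
          rw [hu, Units.val_neg, huu]; simp [linComb]; ring)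
        rw [this, hneg', hsq, htwo]; simp; abel
      · have : u = -u₀ := Units.ext (by rw [hu, Units.val_neg, hu₀]; simp [linComb]; ring)
        rw [this, hneg', hgu]; simp; abel

/-- Here `A` is `𝔽₃ × 𝔽₃` with units `±1, ±s`; the elements `a + b s` with `a b ≠ 0` are zero
divisors. By injectivity `g s` is an involution different from `±1`, hence not scalar. -/
theorem exists_equiv_of_sq_eq_one (hg : Function.Injective g) (hneg : g (-1) = -1)
    (hs : s * s = 1) (hb : Function.Bijective (linComb (ZMod 3) s)) :
    ∃ e : (Fin 2 → ZMod 3) ≃ A, ∀ (u : Aˣ) (p : Fin 2 → ZMod 3), e (g u *ᵥ p) = u * e p := by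
  have hneg' : ∀ u, g (-u) = -g u := fun u => by
    rw [← neg_one_mul, map_mul, hneg, neg_one_mul]
  have hscal : ∀ c : ZMod 3, s ≠ algebraMap (ZMod 3) A c := by
    intro c h
    have := @hb.1 (0, 1) (c, 0) (by simp [linComb, h])
    simp at this
  let u₀ : Aˣ := ⟨s, s, hs, hs⟩
  have hu₀ : (u₀ : A) = s := rfl
  have hsq : u₀ * u₀ = 1 := Units.ext hs
  have hcases : ∀ c : ZMod 3, c = 0 ∨ c = 1 ∨ c = -1 := by decide
  have hXX : g u₀ * g u₀ = 1 := by rw [← map_mul, hsq, map_one]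
  refine exists_equiv_of_map_units_linComb (δ := 1) (by simpa using hs) hb g (X := g u₀)
    (by simpa using hXX) ?_ ?_
  · intro c hc
    rcases hcases c with rfl | rfl | rfl
    · rw [hc] at hXX
      simp at hXX
    · rw [one_smul, ← map_one g] at hc
      exact hscal 1 (by simpa [hu₀] using congrArg Units.val (hg hc))
    · rw [neg_smul, one_smul, ← hneg] at hc
      exact hscal (-1) (by simpa [hu₀] using congrArg Units.val (hg hc))
  · intro u a b hu
    have hzero : ∀ t : A, u * t = 0 → t = 0 := fun t ht => by simpa using ht
    have hmul : ∀ c c' : ZMod 3, (u : A) * linComb (ZMod 3) s (c, c') = 0 → c = 0 ∧ c' = 0 := by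
      intro c c' h
      exact Prod.mk.inj (@hb.1 (c, c') (0, 0) ((hzero _ h).trans (by simp [linComb])))
    rcases hcases a with rfl | rfl | rfl <;> rcases hcases b with rfl | rfl | rfl
    · have := hmul 1 0 (by rw [hu]; simp [linComb])
      simp at this
    · have : u = u₀ := Units.ext (by rw [hu, hu₀]; simp [linComb])
      rw [this]; simp
    · have : u = -u₀ := Units.ext (by rw [hu, Units.val_neg, hu₀]; simp [linComb])
      rw [this, hneg']; simp
    · have : u = 1 := Units.ext (by rw [hu]; simp [linComb])
      rw [this]; simp
    · have := hmul 1 (-1) (by rw [hu]; simp [linComb]; linear_combination -hs)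
      simp at this
    · have := hmul 1 1 (by rw [hu]; simp [linComb]; linear_combination -hs)
      simp at this
    · have : u = -1 := Units.ext (by rw [hu]; simp [linComb])
      rw [this, hneg]; simp
    · have := hmul 1 1 (by rw [hu]; simp [linComb]; linear_combination hs)
      simp at this
    · have := hmul 1 (-1) (by rw [hu]; simp [linComb]; linear_combination hs)
      simp at this

/-- Here `A` is the field with nine elements. Every unit other than 1 has a power equal to `-1`, so
its image fixes no nonzero vector. The eight units thus act simply transitively on the eight nonzero
vectors. An equivariant bijection is all that is needed, so additivity plays no role. -/
theorem exists_equiv_of_sq_eq_neg_one (hneg : g (-1) = -1)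
    (hs : s * s = -1) (hb : Function.Bijective (linComb (ZMod 3) s)) :
    ∃ e : (Fin 2 → ZMod 3) ≃ A, ∀ (u : Aˣ) (p : Fin 2 → ZMod 3), e (g u *ᵥ p) = u * e p := by
  classical
  have h3 : (3 : A) = 0 := by
    rw [← map_ofNat (algebraMap (ZMod 3) A) 3, show (OfNat.ofNat 3 : ZMod 3) = 0 from rfl, map_zero]
  have hcases : ∀ c : ZMod 3, c = 0 ∨ c = 1 ∨ c = -1 := by decide
  have hnt : Nontrivial A := by
    exact ⟨linComb (ZMod 3) s (0, 0), linComb (ZMod 3) s (1, 0), fun h => by simpa using hb.1 h⟩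
  have hunit : ∀ x : A, x ≠ 0 → IsUnit x := by
    intro x hx
    obtain ⟨⟨a, b⟩, rfl⟩ := hb.2 x
    have hab : a * a + b * b ≠ 0 := by
      intro h
      have : ∀ a b : ZMod 3, a * a + b * b = 0 → a = 0 ∧ b = 0 := by decide
      obtain ⟨rfl, rfl⟩ := this a b h
      exact hx (by simp [linComb])
    refine isUnit_of_mul_isUnit_left (y := linComb (ZMod 3) s (a, -b)) ?_
    have e : linComb (ZMod 3) s (a, b) * linComb (ZMod 3) s (a, -b) =
        algebraMap (ZMod 3) A (a * a + b * b) := by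
      simp only [linComb, map_neg, map_add, map_mul]
      linear_combination (-algebraMap (ZMod 3) A b ^ 2) * hs
    rw [e]
    exact (isUnit_iff_ne_zero.2 hab).map _
  -- The squares of `±s` and the fourth powers of `±1 ± s` are `-1`.
  have hpow : ∀ u : Aˣ, u = 1 ∨ ∃ k : ℕ, u ^ k = -1 := by
    intro u
    obtain ⟨⟨a, b⟩, hu⟩ := hb.2 u
    have h0 : ¬ (a = 0 ∧ b = 0) := by
      rintro ⟨rfl, rfl⟩
      exact u.ne_zero (by rw [← hu]; simp [linComb])
    rcases hcases a with rfl | rfl | rfl <;> rcases hcases b with rfl | rfl | rfl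
    · exact absurd ⟨rfl, rfl⟩ h0
    · refine Or.inr ⟨2, Units.ext ?_⟩
      push_cast; rw [← hu]; simp [linComb]; linear_combination hs
    · refine Or.inr ⟨2, Units.ext ?_⟩
      push_cast; rw [← hu]; simp [linComb]; linear_combination hs
    · exact Or.inl (Units.ext (by rw [← hu]; simp [linComb]))
    · refine Or.inr ⟨4, Units.ext ?_⟩
      push_cast; rw [← hu]; simp [linComb]
      linear_combination (s ^ 2 + 4 * s + 5) * hs - h3
    · refine Or.inr ⟨4, Units.ext ?_⟩
      push_cast; rw [← hu]; simp [linComb]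
      linear_combination (s ^ 2 - 4 * s + 5) * hs - h3
    · exact Or.inr ⟨1, Units.ext (by rw [pow_one, ← hu]; simp [linComb])⟩
    · refine Or.inr ⟨4, Units.ext ?_⟩
      push_cast; rw [← hu]; simp [linComb]
      linear_combination (s ^ 2 - 4 * s + 5) * hs - h3
    · refine Or.inr ⟨4, Units.ext ?_⟩
      push_cast; rw [← hu]; simp [linComb]
      linear_combination (s ^ 2 + 4 * s + 5) * hs - h3
  have hinv : ∀ u : Aˣ, g u⁻¹ * g u = 1 := fun u => by rw [← map_mul, inv_mul_cancel, map_one]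
  have hfix : ∀ (u : Aˣ) (p : Fin 2 → ZMod 3), p ≠ 0 → g u *ᵥ p = p → u = 1 := by
    intro u p hp h
    refine (hpow u).resolve_right ?_
    rintro ⟨k, hk⟩
    have hk' : ∀ k : ℕ, g (u ^ k) *ᵥ p = p := by
      intro k
      induction k with
      | zero => simp
      | succ k ih => rw [pow_succ, map_mul, ← Matrix.mulVec_mulVec, h, ih]
    have h1 := hk' k
    rw [hk, hneg, Matrix.neg_mulVec, Matrix.one_mulVec] at h1
    apply hp
    ext i
    have h2 := congrFun h1 i
    have : ∀ c : ZMod 3, -c = c → c = 0 := by decide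
    exact this _ h2
  let p₀ : Fin 2 → ZMod 3 := ![1, 0]
  have hp₀ : p₀ ≠ 0 := fun h => by simpa [p₀] using congrFun h 0
  have hne : ∀ u : Aˣ, g u *ᵥ p₀ ≠ 0 := by
    intro u h
    apply hp₀
    rw [← Matrix.one_mulVec p₀, ← hinv u, ← Matrix.mulVec_mulVec, h, Matrix.mulVec_zero]
  -- The orbit map of `p₀`, extended by `0 ↦ 0`.
  let f : A → (Fin 2 → ZMod 3) := fun x => if hx : x = 0 then 0 else g (hunit x hx).unit *ᵥ p₀
  have hf0 : f 0 = 0 := by simp [f]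
  have hfu : ∀ u : Aˣ, f u = g u *ᵥ p₀ := by
    intro u
    simp only [f, dif_neg u.ne_zero]
    congr 2
    exact Units.ext rfl
  have hf : Function.Bijective f := by
    have hcard : Nat.card A = Nat.card (Fin 2 → ZMod 3) := by
      rw [← Nat.card_congr (Equiv.ofBijective _ hb)]
      simp
    have hfin : Finite A := Finite.of_equiv _ (Equiv.ofBijective _ hb)
    refine (Nat.bijective_iff_injective_and_card _).2 ⟨?_, hcard⟩
    intro x y hxy
    by_cases hx : x = 0
    · by_cases hy : y = 0
      · rw [hx, hy]
      · obtain ⟨u, rfl⟩ := hunit y hy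
        rw [hx, hf0, hfu] at hxy
        exact absurd hxy.symm (hne u)
    · obtain ⟨u, rfl⟩ := hunit x hx
      by_cases hy : y = 0
      · rw [hy, hf0, hfu] at hxy
        exact absurd hxy (hne u)
      · obtain ⟨w, rfl⟩ := hunit y hy
        rw [hfu, hfu] at hxy
        have h := hfix (w⁻¹ * u) p₀ hp₀ (by
          rw [map_mul, ← Matrix.mulVec_mulVec, hxy, Matrix.mulVec_mulVec, hinv,
            Matrix.one_mulVec])
        rw [inv_mul_eq_one.1 h]
  refine ⟨(Equiv.ofBijective f hf).symm, fun u p => ?_⟩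
  obtain ⟨x, rfl⟩ := hf.2 p
  rw [Equiv.symm_apply_eq, Equiv.ofBijective_symm_apply_apply, Equiv.ofBijective_apply]
  by_cases hx : x = 0
  · rw [hx, mul_zero, hf0, Matrix.mulVec_zero]
  · obtain ⟨w, rfl⟩ := hunit x hx
    rw [← Units.val_mul, hfu, hfu, map_mul, Matrix.mulVec_mulVec]

/-- A group of matrices modulo `3` that is isomorphic to the unit group of a ring `A` with nine
elements, compatibly with `-1`, acts on the plane as the unit group acts on `A`. -/
theorem exists_equiv_of_card_nine (hA : Nat.card A = 9) (hg : Function.Injective g)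
    (hneg : g (-1) = -1) :
    ∃ e : (Fin 2 → ZMod 3) ≃ A, ∀ (u : Aˣ) (p : Fin 2 → ZMod 3), e (g u *ᵥ p) = u * e p := by
  obtain ⟨s, δ, hs, hb⟩ := exists_generator_of_card_nine hA
  have hcases : ∀ c : ZMod 3, c = 0 ∨ c = 1 ∨ c = -1 := by decide
  rcases hcases δ with rfl | rfl | rfl
  · exact exists_equiv_of_sq_eq_zero g hg hneg (by simpa using hs) hb
  · exact exists_equiv_of_sq_eq_one g hg hneg (by simpa using hs) hb
  · exact exists_equiv_of_sq_eq_neg_one g hneg (by simpa using hs) hb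

end ModThree

/-! ### The rings `R / (n)` as algebras over `ℤ/n` -/

instance modNAlgebra (R : Type*) [CommRing R] (n : ℕ) : Algebra (ZMod n) (modN R n) :=
  (ZMod.castHom (ringChar.dvd (R := modN R n) (by
    rw [← map_natCast (Ideal.Quotient.mk (Ideal.span {(n : R)}))]
    exact Ideal.Quotient.eq_zero_iff_mem.2 (Ideal.mem_span_singleton_self _)) :
      ringChar (modN R n) ∣ n) (modN R n)).toAlgebra

theorem linComb_intCast {n : ℕ} {A : Type*} [CommRing A] [Algebra (ZMod n) A] (s : A) (a b : ℤ) :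
    linComb (ZMod n) s ((a : ZMod n), (b : ZMod n)) = a + b * s := by
  simp [linComb]

theorem natCast_modN_self (R : Type*) [CommRing R] (n : ℕ) : (n : modN R n) = 0 := by
  rw [← map_natCast (algebraMap (ZMod n) (modN R n)), ZMod.natCast_self, map_zero]

theorem finite_modN {K : Type*} [Field K] [NumberField K] (hK : Module.finrank ℚ K = 2) {n : ℕ}
    (hn : n ≠ 0) : Finite (modN (𝓞 K) n) :=
  Nat.finite_of_card_ne_zero (by rw [card_modN hK]; exact pow_ne_zero 2 hn)

theorem isPrincipalIdealRing_modN (K : Type*) [Field K] [NumberField K] {n : ℕ} (hn : n ≠ 0) :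
    IsPrincipalIdealRing (modN (𝓞 K) n) :=
  isPrincipalIdealRing_quotient (by
    rw [Ne, Ideal.span_singleton_eq_bot]
    exact_mod_cast hn)

theorem bijective_linComb_of_injective {K : Type*} [Field K] [NumberField K]
    (hK : Module.finrank ℚ K = 2) {n : ℕ} (hn : n ≠ 0) {s : modN (𝓞 K) n}
    (h : Function.Injective (linComb (ZMod n) s)) : Function.Bijective (linComb (ZMod n) s) := by
  have := finite_modN hK hn
  have : NeZero n := ⟨hn⟩
  exact (Nat.bijective_iff_injective_and_card _).2 ⟨h, by
    rw [card_modN hK, Nat.card_prod, Nat.card_zmod, sq]⟩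

theorem bijective_linComb_mk {K : Type*} [Field K] [NumberField K]
    (hK : Module.finrank ℚ K = 2) {v : 𝓞 K} {t : ℤ} (ht3 : 3 ≤ t) (hv : v ^ 2 - t * v + 1 = 0)
    {n : ℕ} (hn : n ≠ 0) (ht : (n : ℤ) ∣ t + 1) (h3 : NotExactlyThree n) :
    Function.Bijective (linComb (ZMod n) (Ideal.Quotient.mk _ v : modN (𝓞 K) n)) := by
  refine bijective_linComb_of_injective hK hn ?_
  rintro ⟨a, b⟩ ⟨a', b'⟩ h
  obtain ⟨a, rfl⟩ := ZMod.intCast_surjective a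
  obtain ⟨b, rfl⟩ := ZMod.intCast_surjective b
  obtain ⟨a', rfl⟩ := ZMod.intCast_surjective a'
  obtain ⟨b', rfl⟩ := ZMod.intCast_surjective b'
  rw [linComb_intCast, linComb_intCast] at h
  have h1 : Ideal.Quotient.mk (Ideal.span {(n : 𝓞 K)}) (a' + b' * v) =
      Ideal.Quotient.mk _ (a + b * v) := by
    simpa using h.symm
  rw [Ideal.Quotient.eq] at h1
  obtain ⟨h2, h4⟩ := dvd_of_add_mul_mem_span hK ht3 hv hn ht h3 (a := a' - a) (b := b' - b) (by
    convert h1 using 1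
    push_cast
    ring)
  exact Prod.ext ((ZMod.intCast_eq_intCast_iff_dvd_sub _ _ _).2 h2)
    ((ZMod.intCast_eq_intCast_iff_dvd_sub _ _ _).2 h4)

theorem mk_sq_add_self_add_one {R : Type*} [CommRing R] {v : R} {t : ℤ}
    (hv : v ^ 2 - t * v + 1 = 0) {n : ℕ} (ht : (n : ℤ) ∣ t + 1) :
    (Ideal.Quotient.mk _ v : modN R n) ^ 2 + Ideal.Quotient.mk _ v + 1 = 0 := by
  obtain ⟨k, hk⟩ := ht
  have h1 := congrArg (Ideal.Quotient.mk (Ideal.span {(n : R)})) hv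
  have h2 := congrArg (Int.cast (R := modN R n)) hk
  push_cast at h2
  rw [natCast_modN_self, zero_mul] at h2
  simp only [map_add, map_sub, map_mul, map_pow, map_one, map_zero, map_intCast] at h1
  linear_combination h1 + h2 * (Ideal.Quotient.mk _ v : modN R n)

/-- Ideal factors of `n` are the ideals of `R / (n)`. -/
theorem bijective_map_mk (R : Type*) [CommRing R] [IsDedekindDomain R] (n : ℕ) :
    Function.Bijective fun I : IdealFactor R n =>
      (I.1.map (Ideal.Quotient.mk (Ideal.span {(n : R)})) : Ideal (modN R n)) := by
  have hc : ∀ I : IdealFactor R n,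
      (I.1.map (Ideal.Quotient.mk (Ideal.span {(n : R)}))).comap (Ideal.Quotient.mk _) = I.1 := by
    intro I
    rw [Ideal.comap_map_of_surjective _ Ideal.Quotient.mk_surjective, ← RingHom.ker_eq_comap_bot,
      Ideal.mk_ker, sup_eq_left]
    exact Ideal.le_of_dvd I.2
  constructor
  · intro I J h
    apply Subtype.ext
    rw [← hc I, ← hc J]
    exact congrArg _ h
  · intro J
    refine ⟨⟨J.comap (Ideal.Quotient.mk _), Ideal.dvd_iff_le.2 fun x hx => ?_⟩,
      Ideal.map_comap_of_surjective _ Ideal.Quotient.mk_surjective J⟩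
    rw [Ideal.mem_comap, Ideal.Quotient.eq_zero_iff_mem.2 hx]
    exact J.zero_mem

theorem mem_ker_piMap_iff {R : Type*} [CommRing R] {n : ℕ} (I : IdealFactor R n) (u : (modN R n)ˣ) :
    u ∈ (piMap I).ker ↔ (u : modN R n) - 1 ∈ I.1.map (Ideal.Quotient.mk (Ideal.span {(n : R)})) := by
  have hker : RingHom.ker (Ideal.Quotient.factor (Ideal.le_of_dvd I.2)) =
      I.1.map (Ideal.Quotient.mk (Ideal.span {(n : R)})) := Ideal.Quotient.factor_ker _
  rw [MonoidHom.mem_ker, Units.ext_iff, ← hker, RingHom.mem_ker, map_sub, map_one, sub_eq_zero]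
  rfl

/-! ### The commutant of `F` -/

section Commutant

variable {R : Type*} [CommRing R]

/-- The homomorphism from `R[ω]`, `ω² + ω + 1 = 0`, that maps `ω` to `s`. -/
def eisensteinLift {A : Type*} [Ring A] [Algebra R A] (s : A) (hs : s * s + s + 1 = 0) :
    QuadraticAlgebra R (-1) (-1) →ₐ[R] A :=
  QuadraticAlgebra.lift ⟨s, by
    rw [neg_one_smul, neg_one_smul, ← sub_eq_zero]
    have : s * s - (-1 + -s) = s * s + s + 1 := by abel
    rw [this, hs]⟩

theorem eisensteinLift_apply {A : Type*} [Ring A] [Algebra R A] (s : A) (hs : s * s + s + 1 = 0)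
    (z : QuadraticAlgebra R (-1) (-1)) :
    eisensteinLift (R := R) s hs z = z.re • 1 + z.im • s := by
  simp [eisensteinLift]

theorem eisensteinLift_eq_linComb {A : Type*} [CommRing A] [Algebra R A] (s : A)
    (hs : s * s + s + 1 = 0) (z : QuadraticAlgebra R (-1) (-1)) :
    eisensteinLift (R := R) s hs z = linComb R s (z.re, z.im) := by
  rw [eisensteinLift_apply, linComb, Algebra.smul_def, Algebra.smul_def, mul_one]

variable {F : GL (Fin 2) R} {p : Fin 2 → R}

theorem eisensteinLift_matrix_injective (hp : IsCyclicVector F.1 p)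
    (hF : F.1 * F.1 + F.1 + 1 = 0) : Function.Injective (eisensteinLift (R := R) F.1 hF) := by
  intro x y h
  rw [eisensteinLift_apply, eisensteinLift_apply] at h
  obtain ⟨h1, h2⟩ := hp.coeff_unique h
  exact QuadraticAlgebra.ext h1 h2

/-- The units of `R[ω]` as invertible matrices. -/
def eisensteinUnits (F : GL (Fin 2) R) (hF : F.1 * F.1 + F.1 + 1 = 0) :
    (QuadraticAlgebra R (-1) (-1))ˣ →* GL (Fin 2) R :=
  Units.map (eisensteinLift (R := R) F.1 hF).toMonoidHom

theorem eisensteinUnits_injective (hp : IsCyclicVector F.1 p)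
    (hF : F.1 * F.1 + F.1 + 1 = 0) : Function.Injective (eisensteinUnits F hF) :=
  Units.map_injective (eisensteinLift_matrix_injective hp hF)

theorem coe_eisensteinUnits (hF : F.1 * F.1 + F.1 + 1 = 0)
    (u : (QuadraticAlgebra R (-1) (-1))ˣ) :
    (eisensteinUnits F hF u).1 = u.1.re • (1 : Matrix (Fin 2) (Fin 2) R) + u.1.im • F.1 :=
  eisensteinLift_apply _ _ _

/-- The commutant of a matrix with a cyclic vector is `R[F]`. The inverse of a commuting matrix
commutes too, so both lie in `R[F]`, and their preimages in `R[ω]` are mutually inverse. -/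
theorem mem_range_eisensteinUnits_iff (hp : IsCyclicVector F.1 p)
    (hF : F.1 * F.1 + F.1 + 1 = 0) (G : GL (Fin 2) R) :
    G ∈ (eisensteinUnits F hF).range ↔ G * F = F * G := by
  constructor
  · rintro ⟨u, rfl⟩
    apply Units.ext
    rw [Units.val_mul, Units.val_mul, coe_eisensteinUnits, commute_smul_one_add_smul]
  · intro hG
    have key : ∀ H : GL (Fin 2) R, H * F = F * H →
        ∃ z, eisensteinLift (R := R) F.1 hF z = H.1 := by
      intro H hH
      obtain ⟨a, b, h⟩ := hp.exists_eq (G := H.1) (congrArg Units.val hH)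
      exact ⟨⟨a, b⟩, by rw [eisensteinLift_apply, h]⟩
    obtain ⟨x, hx⟩ := key G hG
    obtain ⟨y, hy⟩ := key G⁻¹ (Commute.inv_left (a := G) (b := F) hG)
    refine ⟨⟨x, y, eisensteinLift_matrix_injective hp hF ?_,
      eisensteinLift_matrix_injective hp hF ?_⟩, Units.ext hx⟩
    · rw [map_mul, hx, hy, map_one, ← Units.val_mul, mul_inv_cancel, Units.val_one]
    · rw [map_mul, hx, hy, map_one, ← Units.val_mul, inv_mul_cancel, Units.val_one]

variable {A : Type*} [CommRing A] [Algebra R A] {s : A}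

/-- Both groups are the units of `R[ω]`, through `ω ↦ F` and `ω ↦ s`. -/
theorem exists_commutant_mulEquiv (hp : IsCyclicVector F.1 p)
    (hF : F.1 * F.1 + F.1 + 1 = 0) (hs : s ^ 2 + s + 1 = 0) (hb : Function.Bijective (linComb R s))
    (M : Subgroup (GL (Fin 2) R)) (hM : ∀ G, G ∈ M ↔ G * F = F * G) :
    ∃ j : M ≃* Aˣ, ∀ (G : M) (a b : R),
      G.1.1 = a • (1 : Matrix (Fin 2) (Fin 2) R) + b • F.1 → (j G : A) = linComb R s (a, b) := by
  have hs' : s * s + s + 1 = 0 := by rw [← sq]; exact hs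
  have hbij : Function.Bijective (eisensteinLift (R := R) s hs') := by
    have : ⇑(eisensteinLift (R := R) s hs') = linComb R s ∘ QuadraticAlgebra.equivProd (-1) (-1) :=
      funext fun z => eisensteinLift_eq_linComb s hs' z
    rw [this]
    exact hb.comp (Equiv.bijective _)
  have hrange : M = (eisensteinUnits F hF).range := by
    ext G
    rw [hM, mem_range_eisensteinUnits_iff hp hF]
  let j₁ : (QuadraticAlgebra R (-1) (-1))ˣ ≃* M :=
    (MonoidHom.ofInjective (eisensteinUnits_injective hp hF)).trans
      (MulEquiv.subgroupCongr hrange.symm)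
  let j₂ : (QuadraticAlgebra R (-1) (-1))ˣ ≃* Aˣ :=
    Units.mapEquiv (RingEquiv.ofBijective (eisensteinLift (R := R) s hs') hbij).toMulEquiv
  refine ⟨j₁.symm.trans j₂, fun G a b hG => ?_⟩
  obtain ⟨u, rfl⟩ := j₁.surjective G
  have h1 : (j₁ u).1.1 = u.1.re • (1 : Matrix (Fin 2) (Fin 2) R) + u.1.im • F.1 :=
    coe_eisensteinUnits hF u
  obtain ⟨h2, h3⟩ := hp.coeff_unique (h1.symm.trans hG)
  rw [MulEquiv.trans_apply, MulEquiv.symm_apply_apply, ← h2, ← h3]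
  exact eisensteinLift_eq_linComb s hs' _

/-- Since `M` is the image of `R[ω]ˣ` and `j` is injective, the only unit congruent to one modulo
the kernel of `ω ↦ s` is 1. By `ideal_le_of_units_congruent` the kernel is zero. This gives
independence of `1, s` without any condition on the prime 3. -/
theorem injective_linComb_of_injective_units [Finite R] (hp : IsCyclicVector F.1 p)
    (hF : F.1 * F.1 + F.1 + 1 = 0) (hs : s ^ 2 + s + 1 = 0)
    (M : Subgroup (GL (Fin 2) R)) (hM : ∀ G, G ∈ M ↔ G * F = F * G)
    (j : M →* Aˣ) (hj : Function.Injective j) (hjF : ∀ (G : M) (a b : R),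
      G.1.1 = a • (1 : Matrix (Fin 2) (Fin 2) R) + b • F.1 → (j G : A) = linComb R s (a, b)) :
    Function.Injective (linComb R s) := by
  have hs' : s * s + s + 1 = 0 := by rw [← sq]; exact hs
  have : Finite (QuadraticAlgebra R (-1) (-1)) :=
    Finite.of_equiv _ (QuadraticAlgebra.equivProd (-1 : R) (-1)).symm
  let ψ := eisensteinLift (R := R) s hs'
  have hker : RingHom.ker ψ ≤ ⊥ := by
    refine ideal_le_of_units_congruent (v := QuadraticAlgebra.omega) ?_ fun u hu => ?_
    · ext <;> simp [sq, QuadraticAlgebra.re_one, QuadraticAlgebra.im_one]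
    · have hmem : eisensteinUnits F hF u ∈ M :=
        (hM _).2 ((mem_range_eisensteinUnits_iff hp hF _).1 ⟨u, rfl⟩)
      have h1 := hjF ⟨_, hmem⟩ u.1.re u.1.im (coe_eisensteinUnits hF u)
      rw [← eisensteinLift_eq_linComb s hs'] at h1
      have h2 : ψ u.1 = 1 := by
        rw [RingHom.mem_ker, map_sub, map_one, sub_eq_zero] at hu
        exact hu
      have h3 : j ⟨_, hmem⟩ = 1 := Units.ext (h1.trans h2)
      have h4 := congrArg Subtype.val (hj (h3.trans (map_one j).symm))
      have h5 : u = 1 := eisensteinUnits_injective hp hF (h4.trans (map_one _).symm)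
      rw [h5, Units.val_one, sub_self]
      exact Ideal.zero_mem _
  have hinj : Function.Injective ψ := (RingHom.injective_iff_ker_eq_bot _).2 (le_bot_iff.1 hker)
  rintro ⟨a, b⟩ ⟨a', b'⟩ h
  have h1 : (⟨a, b⟩ : QuadraticAlgebra R (-1) (-1)) = ⟨a', b'⟩ := hinj (by
    change eisensteinLift (R := R) s hs' _ = eisensteinLift (R := R) s hs' _
    rw [eisensteinLift_eq_linComb, eisensteinLift_eq_linComb]
    exact h)
  exact Prod.ext (congrArg QuadraticAlgebra.re h1) (congrArg QuadraticAlgebra.im h1)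

end Commutant

/-! ### Maximal abelian subgroups -/

/-- Adjoining `x` to `M` generates an abelian subgroup of `C`, which maximality forces back into
`M`. -/
theorem IsMaximalAbelianIn.mem_of_commute {G : Type*} [Group G] {M C : Subgroup G}
    (hM : IsMaximalAbelianIn M C) {x : G} (hx : x ∈ C) (hxM : ∀ y ∈ M, x * y = y * x) : x ∈ M := by
  have hcomm : ∀ y ∈ insert x (M : Set G), ∀ y' ∈ insert x (M : Set G), y * y' = y' * y := by
    rintro y (rfl | hy) y' (rfl | hy')
    · rfl
    · exact hxM _ hy'
    · exact (hxM _ hy).symm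
    · exact hM.1.2 _ hy _ hy'
  have hle : M ≤ Subgroup.closure (insert x (M : Set G)) := fun y hy =>
    Subgroup.subset_closure (Set.mem_insert_of_mem _ hy)
  have := Subgroup.isMulCommutative_closure hcomm
  refine hM.2 ⟨?_, fun y hy y' hy' => ?_⟩ hle (Subgroup.subset_closure (Set.mem_insert _ _))
  · rw [Subgroup.closure_le]
    rintro y (rfl | hy)
    exacts [hx, hM.1.1 hy]
  · exact setLike_mul_comm hy hy'

theorem symGroup_le_galM (d : ℕ) [NeZero d] (D : ℕ) (z : ZMod d → ℂ) :
    symGroup d z ≤ galM d D z := by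
  intro G hG
  exact ⟨1, one_mem _, fun p => Subtype.ext (hG p).symm⟩

/-! ### The group `M` as the centralizer of `F` -/

section Galois

variable {d : ℕ} [NeZero d] {D : ℕ} {z : ZMod d → ℂ} {F : GL2 d}

theorem commute_of_mem_galM (hM : IsMaximalAbelianIn (galM d D z)
      (Subgroup.centralizer (symGroup d z : Set (GL2 d)))) (hF : F ∈ symGroup d z) {G : GL2 d}
    (hG : G ∈ galM d D z) : G * F = F * G :=
  ((Subgroup.mem_centralizer_iff.1 (hM.1.1 hG)) F hF).symm

theorem neg_one_mem_galM (hM : IsMaximalAbelianIn (galM d D z)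
      (Subgroup.centralizer (symGroup d z : Set (GL2 d)))) : -1 ∈ galM d D z :=
  hM.mem_of_commute (Subgroup.mem_centralizer_iff.2 fun g _ => by simp) fun y _ => by simp

/-- Elements of `M` commute with `F`, so they have the form `a I + b F`. A matrix commuting with `F`
therefore commutes with `M`, in particular with `S ≤ M`, and maximality applies. -/
theorem mem_galM_iff (hM : IsMaximalAbelianIn (galM d D z)
      (Subgroup.centralizer (symGroup d z : Set (GL2 d)))) (hF : F ∈ symGroup d z)
    {p : Idx d} (hp : IsCyclicVector F.1 p) (G : GL2 d) : G ∈ galM d D z ↔ G * F = F * G := by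
  refine ⟨commute_of_mem_galM hM hF, fun hG => ?_⟩
  have hcomm : ∀ H ∈ galM d D z, G * H = H * G := by
    intro H hH
    obtain ⟨a, b, hab⟩ := hp.exists_eq (G := H.1) (congrArg Units.val (commute_of_mem_galM hM hF hH))
    apply Units.ext
    have hG' : G.1 * F.1 = F.1 * G.1 := congrArg Units.val hG
    rw [Units.val_mul, Units.val_mul, hab, mul_add, add_mul, mul_smul_comm, mul_smul_comm,
      smul_mul_assoc, smul_mul_assoc, hG', mul_one, one_mul]
  exact hM.mem_of_commute (Subgroup.mem_centralizer_iff.2 fun H hH =>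
    (hcomm H (symGroup_le_galM d D z hH)).symm) hcomm

end Galois

/-! ### Splitting off the prime 3 -/

theorem dbar_ne_zero (d : ℕ) [NeZero d] : dbar d ≠ 0 := by
  have := NeZero.ne d
  unfold dbar
  split_ifs <;> omega

/-- For `d ≥ 4` the number `(d - 3)(d + 1)` lies strictly between `(d - 2)²` and `(d - 1)²`. -/
theorem not_isSquare_of_isSquarefreePart {d D : ℕ} (hd : 4 ≤ d)
    (hD : IsSquarefreePart D ((d - 3) * (d + 1))) : ¬ IsSquare D := by
  rintro ⟨c, rfl⟩
  obtain ⟨-, k, hk⟩ := hD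
  obtain ⟨e, rfl⟩ := Nat.exists_eq_add_of_le hd
  have h1 : 4 + e - 3 = e + 1 := by omega
  rw [h1] at hk
  have h2 : (e + 1) * (4 + e + 1) = (c * k) ^ 2 := by rw [hk]; ring
  have h3 : e + 2 < c * k := lt_of_pow_lt_pow_left₀ 2 (Nat.zero_le _) (by rw [← h2]; nlinarith)
  have h4 : c * k < e + 3 := lt_of_pow_lt_pow_left₀ 2 (Nat.zero_le _) (by rw [← h2]; nlinarith)
  omega

theorem castHom_eq_of_coprime {n a b : ℕ} (hab : a.Coprime b) (hn : n = a * b) (ha : a ∣ n)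
    (hb : b ∣ n) {x y : ZMod n} (h₁ : ZMod.castHom ha (ZMod a) x = ZMod.castHom ha (ZMod a) y)
    (h₂ : ZMod.castHom hb (ZMod b) x = ZMod.castHom hb (ZMod b) y) : x = y := by
  obtain ⟨x, rfl⟩ := ZMod.intCast_surjective x
  obtain ⟨y, rfl⟩ := ZMod.intCast_surjective y
  rw [map_intCast, map_intCast, ZMod.intCast_eq_intCast_iff_dvd_sub] at h₁ h₂
  rw [ZMod.intCast_eq_intCast_iff_dvd_sub, hn]
  push_cast
  exact (Nat.isCoprime_iff_coprime.2 hab).mul_dvd h₁ h₂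

theorem coprime_three_div {n : ℕ} (h3 : 3 ∣ n) (h9 : ¬ NotExactlyThree n) :
    Nat.Coprime 3 (n / 3) := by
  rw [Nat.Prime.coprime_iff_not_dvd Nat.prime_three]
  intro h
  apply h9
  intro _
  have := Nat.mul_dvd_mul_left 3 h
  rwa [Nat.mul_div_cancel' h3] at this

theorem notExactlyThree_of_coprime {n : ℕ} (h : Nat.Coprime 3 n) : NotExactlyThree n :=
  fun h3 => absurd h3 ((Nat.Prime.coprime_iff_not_dvd Nat.prime_three).1 h)

theorem int_comb_eq {n : ℕ} (F : Matrix (Fin 2) (Fin 2) (ZMod n)) (a b : ℤ) :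
    (a : Matrix (Fin 2) (Fin 2) (ZMod n)) + b • F =
      (a : ZMod n) • (1 : Matrix (Fin 2) (Fin 2) (ZMod n)) + (b : ZMod n) • F := by
  rw [Int.cast_smul_eq_zsmul, Int.cast_smul_eq_zsmul, zsmul_eq_mul (1 : Matrix _ _ _), mul_one]

/-! ### Reduction modulo a divisor of `d̄` -/

section Reduce

variable {d : ℕ} {m : ℕ} (h : m ∣ dbar d)

/-- Reduction of index vectors modulo a divisor of `d̄`. -/
def reduceIdx (p : Idx d) : Fin 2 → ZMod m := fun i => ZMod.castHom h (ZMod m) (p i)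

theorem coe_reduceGL (G : GL2 d) : (reduceGL d h G).1 = G.1.map (ZMod.castHom h (ZMod m)) := rfl

theorem reduceIdx_mulVec (G : GL2 d) (p : Idx d) :
    reduceIdx h (G.1 *ᵥ p) = (reduceGL d h G).1 *ᵥ reduceIdx h p := by
  funext i
  exact RingHom.map_mulVec (ZMod.castHom h (ZMod m)) G.1 p i

theorem reduceGL_commute {F G : GL2 d} (hG : G * F = F * G) :
    reduceGL d h G * reduceGL d h F = reduceGL d h F * reduceGL d h G := by
  rw [← map_mul, hG, map_mul]

theorem trace_reduceGL {F : GL2 d} (hF : F.1.trace = -1) : (reduceGL d h F).1.trace = -1 := by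
  rw [coe_reduceGL, Matrix.trace_fin_two]
  rw [Matrix.trace_fin_two] at hF
  simpa [-ZMod.castHom_apply] using congrArg (ZMod.castHom h (ZMod m)) hF

theorem det_reduceGL {F : GL2 d} (hF : F.1.det = 1) : (reduceGL d h F).1.det = 1 := by
  rw [coe_reduceGL, Matrix.det_fin_two]
  rw [Matrix.det_fin_two] at hF
  simpa [-ZMod.castHom_apply] using congrArg (ZMod.castHom h (ZMod m)) hF

theorem reduceGL_neg_one : reduceGL d h (-1) = -1 := by
  apply Units.ext
  rw [coe_reduceGL]
  ext i j
  fin_cases i <;> fin_cases j <;> simp [-ZMod.castHom_apply]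

theorem reduceGL_comb {F G : GL2 d} {a b : ZMod (dbar d)}
    (hG : G.1 = a • (1 : Matrix (Fin 2) (Fin 2) (ZMod (dbar d))) + b • F.1) :
    (reduceGL d h G).1 = ZMod.castHom h (ZMod m) a • (1 : Matrix (Fin 2) (Fin 2) (ZMod m)) +
      ZMod.castHom h (ZMod m) b • (reduceGL d h F).1 := by
  rw [coe_reduceGL, coe_reduceGL, hG]
  ext i j
  fin_cases i <;> fin_cases j <;> simp [-ZMod.castHom_apply]

end Reduce

theorem bijective_reduceIdx {d : ℕ} [NeZero d] (h3 : 3 ∣ dbar d)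
    (hco : Nat.Coprime 3 (dbar d / 3)) :
    Function.Bijective fun p : Idx d =>
      (reduceIdx h3 p, reduceIdx (Nat.div_dvd_of_dvd h3) p) := by
  have hn := dbar_ne_zero d
  have hm : dbar d = 3 * (dbar d / 3) := (Nat.mul_div_cancel' h3).symm
  have : NeZero (dbar d) := ⟨hn⟩
  have : NeZero (dbar d / 3) := ⟨fun h => hn (by omega)⟩
  refine (Nat.bijective_iff_injective_and_card _).2 ⟨fun p q hpq => ?_, ?_⟩
  · obtain ⟨h1, h2⟩ := Prod.mk.inj hpq
    funext i
    exact castHom_eq_of_coprime hco hm h3 (Nat.div_dvd_of_dvd h3) (congrFun h1 i) (congrFun h2 i)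
  · simp only [Nat.card_eq_fintype_card, Fintype.card_prod, Fintype.card_fun, ZMod.card, Fintype.card_fin]
    rw [← mul_pow, ← hm]

/-- A map of the form `(j', j^×)` comes with an equivariant parametrization of `(ℤ/d̄)²`. -/
theorem IsSplitMap.exists_equiv {d D : ℕ} [NeZero d] (hD : ¬ IsSquare D)
    {M : Subgroup (GL2 d)} {F : GL2 d} (htr : F.1.trace = -1) (hdet : F.1.det = 1)
    (hMF : ∀ G ∈ M, G * F = F * G) (hneg : -1 ∈ M) {v : 𝓞 (quadField D)} {t : ℤ} (ht3 : 3 ≤ t)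
    (hv : v ^ 2 - t * v + 1 = 0) (ht : (dbar d : ℤ) ∣ t + 1) {h3 : 3 ∣ dbar d}
    (hco : Nat.Coprime 3 (dbar d / 3)) {R : Type*} [CommRing R] (hR : Nat.card (modN R 3) = 9)
    {φ : M →* (modN R 3)ˣ × (modN (𝓞 (quadField D)) (dbar d / 3))ˣ}
    (hφ : IsSplitMap d D M F v h3 R φ) :
    ∃ e : Idx d ≃ modN R 3 × modN (𝓞 (quadField D)) (dbar d / 3), ∀ (G : M) (p : Idx d),
      e (G.1.1 *ᵥ p) = (((φ G).1 : modN R 3), ((φ G).2 : modN (𝓞 (quadField D)) (dbar d / 3))) *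
        e p := by
  have := numberField_quadField hD
  have hn := dbar_ne_zero d
  have hm0 : dbar d / 3 ≠ 0 := fun h => hn (by omega)
  have hmd : dbar d / 3 ∣ dbar d := Nat.div_dvd_of_dvd h3
  have htm : ((dbar d / 3 : ℕ) : ℤ) ∣ t + 1 := (Int.natCast_dvd_natCast.2 hmd).trans ht
  obtain ⟨⟨j', hj'scal, hj'⟩, hφ2⟩ := hφ
  have hneg3 : -1 ∈ M.map (reduceGL d h3) := ⟨-1, hneg, reduceGL_neg_one h3⟩
  -- Modulo 3 the matrix `F` may be scalar and says nothing about `j'`; only the isomorphism and its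
  -- value at `-1` enter.
  obtain ⟨e₃, he₃⟩ := exists_equiv_of_card_nine (A := modN R 3)
    (((Units.coeHom _).comp (M.map (reduceGL d h3)).subtype).comp j'.symm.toMonoidHom) hR
    (Units.val_injective.comp (Subtype.val_injective.comp j'.symm.injective)) (by
      have h1 : j' ⟨-1, hneg3⟩ = -1 := Units.ext (by
        simpa using hj'scal (-1) ⟨-1, hneg3⟩ (by simp))
      change (j'.symm (-1)).1.1 = -1
      rw [← h1, MulEquiv.symm_apply_apply]
      rfl)
  have hgood := notExactlyThree_of_coprime hco
  obtain ⟨p₀, hp₀⟩ := exists_isCyclicVector hm0 hgood (trace_reduceGL hmd htr) (det_reduceGL hmd hdet)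
  have hFm := sq_add_self_add_one (trace_reduceGL hmd htr) (det_reduceGL hmd hdet)
  have hvm := mk_sq_add_self_add_one hv htm
  obtain ⟨e₂, he₂⟩ := exists_equiv_of_isCyclicVector (γ := -1) (δ := -1) hp₀
    (by simp only [neg_smul, one_smul]; rw [← sub_eq_zero, ← hFm]; abel)
    (by rw [map_neg, map_one]; linear_combination hvm)
    (bijective_linComb_mk (finrank_quadField hD) ht3 hv hm0 htm hgood)
  refine ⟨(Equiv.ofBijective _ (bijective_reduceIdx h3 hco)).trans (e₃.prodCongr e₂),
    fun G p => ?_⟩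
  refine Prod.ext ?_ ?_
  · change e₃ (reduceIdx h3 (G.1.1 *ᵥ p)) = (φ G).1 * e₃ (reduceIdx h3 p)
    rw [reduceIdx_mulVec, hj', ← he₃]
    congr 2
    change _ = (j'.symm _).1.1
    rw [MulEquiv.symm_apply_apply]
  · change e₂ (reduceIdx hmd (G.1.1 *ᵥ p)) = (φ G).2 * e₂ (reduceIdx hmd p)
    obtain ⟨a, b, hab⟩ := hp₀.exists_eq (G := (reduceGL d hmd G.1).1)
      (congrArg Units.val (reduceGL_commute hmd (hMF _ G.2)))
    obtain ⟨a, rfl⟩ := ZMod.intCast_surjective a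
    obtain ⟨b, rfl⟩ := ZMod.intCast_surjective b
    rw [reduceIdx_mulVec, hab, he₂, linComb_intCast, hφ2 G a b (by rw [hab, int_comb_eq])]
    simp

theorem not_notExactlyThree_of_not_isTypeZ {d : ℕ} [NeZero d] {F : GL2 d}
    (htr : F.1.trace = -1) (hdet : F.1.det = 1) (hF : ¬ IsTypeZ d F) :
    ¬ NotExactlyThree (dbar d) := by
  intro h
  obtain ⟨p, hp⟩ := exists_isCyclicVector (dbar_ne_zero d) h htr hdet
  exact hF (hp.isConj (sq_add_self_add_one htr hdet))

/-! ### Orbit correspondences -/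

section Correspondence

variable {d D : ℕ} [NeZero d] {M : Subgroup (GL2 d)} {F : GL2 d} {v : 𝓞 (quadField D)} {t : ℤ}

/-- No condition on 3 is needed: that `1, v` is a basis modulo `d̄` is extracted from the
injectivity of `j`. -/
theorem isOrbitCorrespondence_of_isTypeZ (hD : ¬ IsSquare D) (hv : v ^ 2 - t * v + 1 = 0)
    (ht : (dbar d : ℤ) ∣ t + 1) (hM : ∀ G, G ∈ M ↔ G * F = F * G)
    (hF : F.1 * F.1 + F.1 + 1 = 0) {p : Idx d} (hp : IsCyclicVector F.1 p)
    (j : M ≃* (modN (𝓞 (quadField D)) (dbar d))ˣ)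
    (hj : ∀ (G : M) (a b : ℤ), G.1.1 = (a : Matrix (Fin 2) (Fin 2) (ZMod (dbar d))) + b • F.1 →
      (j G : modN (𝓞 (quadField D)) (dbar d)) = Ideal.Quotient.mk _ (a + b * v)) :
    IsOrbitCorrespondence M fun n : IdealFactor (𝓞 (quadField D)) (dbar d) =>
      (piMap n).ker.comap j.toMonoidHom := by
  have := numberField_quadField hD
  have hK := finrank_quadField hD
  have hn := dbar_ne_zero d
  have : NeZero (dbar d) := ⟨hn⟩
  have := finite_modN hK hn
  have := isPrincipalIdealRing_modN (quadField D) hn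
  have hv' := mk_sq_add_self_add_one hv ht
  have hj' : ∀ (G : M) (a b : ZMod (dbar d)),
      G.1.1 = a • (1 : Matrix (Fin 2) (Fin 2) (ZMod (dbar d))) + b • F.1 →
      (j G : modN (𝓞 (quadField D)) (dbar d)) =
        linComb (ZMod (dbar d)) (Ideal.Quotient.mk _ v) (a, b) := by
    intro G a b hG
    obtain ⟨a, rfl⟩ := ZMod.intCast_surjective a
    obtain ⟨b, rfl⟩ := ZMod.intCast_surjective b
    rw [hj G a b (by rw [hG, int_comb_eq]), linComb_intCast]
    simp
  have hb := bijective_linComb_of_injective hK hn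
    (injective_linComb_of_injective_units hp hF hv' M hM j.toMonoidHom j.injective hj')
  obtain ⟨e, he⟩ := exists_equiv_of_isCyclicVector (γ := -1) (δ := -1) hp
    (by simp only [neg_smul, one_smul]; rw [← sub_eq_zero, ← hF]; abel)
    (by rw [map_neg, map_one]; linear_combination hv') hb
  refine isOrbitCorrespondence_of_equivariant M hv' j e (fun G q => ?_)
    (fun I : IdealFactor (𝓞 (quadField D)) (dbar d) => I.1.map (Ideal.Quotient.mk _))
    (bijective_map_mk _ _) _ (fun I G => mem_ker_piMap_iff I (j G))
  obtain ⟨a, b, hab⟩ := hp.exists_eq (G := G.1.1) (congrArg Units.val ((hM _).1 G.2))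
  rw [hj' G a b hab, hab, he]

theorem isOrbitCorrespondence_of_isSplitMap (hD : ¬ IsSquare D) (htr : F.1.trace = -1)
    (hdet : F.1.det = 1) (hMF : ∀ G ∈ M, G * F = F * G) (hneg : -1 ∈ M) (ht3 : 3 ≤ t)
    (hv : v ^ 2 - t * v + 1 = 0) (ht : (dbar d : ℤ) ∣ t + 1) {h3 : 3 ∣ dbar d}
    (hco : Nat.Coprime 3 (dbar d / 3)) {L : Type*} [Field L] [NumberField L]
    (hL : Module.finrank ℚ L = 2)
    (φ : M ≃* (modN (𝓞 L) 3)ˣ × (modN (𝓞 (quadField D)) (dbar d / 3))ˣ)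
    (hφ : IsSplitMap d D M F v h3 (𝓞 L) φ.toMonoidHom) :
    IsOrbitCorrespondence M fun n : IdealFactor (𝓞 L) 3 ×
        IdealFactor (𝓞 (quadField D)) (dbar d / 3) =>
      ((piMap n.1).ker.prod (piMap n.2).ker).comap φ.toMonoidHom := by
  have := numberField_quadField hD
  have hK := finrank_quadField hD
  have hm0 : dbar d / 3 ≠ 0 := fun h => dbar_ne_zero d (by omega)
  have hmd : dbar d / 3 ∣ dbar d := Nat.div_dvd_of_dvd h3
  have := finite_modN hK hm0
  have := finite_modN hL three_ne_zero
  have := isPrincipalIdealRing_modN (quadField D) hm0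
  have := isPrincipalIdealRing_modN L three_ne_zero
  have hv' := mk_sq_add_self_add_one hv ((Int.natCast_dvd_natCast.2 hmd).trans ht)
  obtain ⟨e, he⟩ := hφ.exists_equiv hD htr hdet hMF hneg ht3 hv ht hco (by rw [card_modN hL]; norm_num)
  -- In the first factor `1` serves as a root of `X² + X + 1`, since `3 = 0` there.
  refine isOrbitCorrespondence_of_equivariant M
    (A := modN (𝓞 L) 3 × modN (𝓞 (quadField D)) (dbar d / 3))
    (v := (1, Ideal.Quotient.mk _ v)) (Prod.ext ?_ hv') (φ.trans MulEquiv.prodUnits.symm) e he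
    (fun n => Ideal.prod (n.1.1.map (Ideal.Quotient.mk _)) (n.2.1.map (Ideal.Quotient.mk _)))
    ?_ _ fun n G => ?_
  · have := natCast_modN_self (𝓞 L) 3
    push_cast at this
    change (1 : modN (𝓞 L) 3) ^ 2 + 1 + 1 = 0
    linear_combination this
  · exact Ideal.idealProdEquiv.symm.bijective.comp
      (Function.Bijective.prodMap (bijective_map_mk (𝓞 L) 3) (bijective_map_mk _ _))
  · rw [Subgroup.mem_comap, Subgroup.mem_prod, mem_ker_piMap_iff, mem_ker_piMap_iff,
      Ideal.mem_prod]
    rfl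

/-- The reduction `R / (n) → R / (m)` for a divisor `m` of `n`. -/
def modFactor (R : Type*) [CommRing R] {m n : ℕ} (h : m ∣ n) : modN R n →+* modN R m :=
  Ideal.Quotient.factor (Ideal.le_of_dvd (natFactor R h).2)

theorem bijective_factor_prod {K : Type*} [Field K] [NumberField K]
    (hK : Module.finrank ℚ K = 2) {n : ℕ} (hn : n ≠ 0) (h3 : 3 ∣ n) (hco : Nat.Coprime 3 (n / 3)) :
    Function.Bijective ((modFactor (𝓞 K) h3).prod (modFactor (𝓞 K) (Nat.div_dvd_of_dvd h3))) := by
  have hm : n = 3 * (n / 3) := (Nat.mul_div_cancel' h3).symm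
  have hm0 : n / 3 ≠ 0 := by omega
  have := finite_modN hK hn
  have := finite_modN hK hm0
  have := finite_modN hK three_ne_zero
  refine (Nat.bijective_iff_injective_and_card _).2 ⟨?_, ?_⟩
  · rw [injective_iff_map_eq_zero]
    intro x hx
    obtain ⟨x, rfl⟩ := Ideal.Quotient.mk_surjective x
    obtain ⟨h1, h2⟩ := Prod.mk.inj hx
    have h1' : x ∈ Ideal.span {((3 : ℕ) : 𝓞 K)} := Ideal.Quotient.eq_zero_iff_mem.1 h1
    have h2' : x ∈ Ideal.span {((n / 3 : ℕ) : 𝓞 K)} := Ideal.Quotient.eq_zero_iff_mem.1 h2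
    rw [Ideal.mem_span_singleton] at h1' h2'
    rw [Ideal.Quotient.eq_zero_iff_mem, Ideal.mem_span_singleton, hm, Nat.cast_mul]
    have h4 := (Nat.isCoprime_iff_coprime.2 hco).map (Int.castRingHom (𝓞 K))
    simp only [eq_intCast, Int.cast_natCast] at h4
    exact h4.mul_dvd h1' h2'
  · rw [Nat.card_prod, card_modN hK, card_modN hK, card_modN hK, ← mul_pow, ← hm]

theorem isOrbitCorrespondence_of_not_isTypeZ (hD : ¬ IsSquare D) (htr : F.1.trace = -1)
    (hdet : F.1.det = 1) (hMF : ∀ G ∈ M, G * F = F * G) (hneg : -1 ∈ M) (ht3 : 3 ≤ t)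
    (hv : v ^ 2 - t * v + 1 = 0) (ht : (dbar d : ℤ) ∣ t + 1) {h3 : 3 ∣ dbar d}
    (hco : Nat.Coprime 3 (dbar d / 3)) (j : M ≃* (modN (𝓞 (quadField D)) (dbar d))ˣ)
    (hj : IsSplitMap d D M F v h3 (𝓞 (quadField D))
      (((piMap (natFactor (𝓞 (quadField D)) h3)).prod
        (piMap (natFactor (𝓞 (quadField D)) (Nat.div_dvd_of_dvd h3)))).comp j.toMonoidHom)) :
    IsOrbitCorrespondence M fun n : IdealFactor (𝓞 (quadField D)) (dbar d) =>
      (piMap n).ker.comap j.toMonoidHom := by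
  have := numberField_quadField hD
  have hK := finrank_quadField hD
  have hn := dbar_ne_zero d
  have := finite_modN hK hn
  have := isPrincipalIdealRing_modN (quadField D) hn
  obtain ⟨e, he⟩ := hj.exists_equiv hD htr hdet hMF hneg ht3 hv ht hco (by rw [card_modN hK]; norm_num)
  let χ := RingEquiv.ofBijective _ (bijective_factor_prod hK hn h3 hco)
  refine isOrbitCorrespondence_of_equivariant M (mk_sq_add_self_add_one hv ht) j
    (e.trans χ.symm.toEquiv) (fun G q => ?_)
    (fun I : IdealFactor (𝓞 (quadField D)) (dbar d) => I.1.map (Ideal.Quotient.mk _))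
    (bijective_map_mk _ _) _ (fun I G => mem_ker_piMap_iff I (j G))
  apply χ.injective
  rw [map_mul]
  change χ (χ.symm (e _)) = χ (j G) * χ (χ.symm (e q))
  rw [RingEquiv.apply_symm_apply, RingEquiv.apply_symm_apply]
  exact he G q

/-- Its contrapositive shows that 3 divides `d̄` exactly when a type `z` fiducial is not algebraic.
-/
theorem isAlgebraicFor_of_notExactlyThree (hD : ¬ IsSquare D) (htr : F.1.trace = -1)
    (hdet : F.1.det = 1) (ht3 : 3 ≤ t) (hv : v ^ 2 - t * v + 1 = 0) (ht : (dbar d : ℤ) ∣ t + 1)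
    (hM : ∀ G, G ∈ M ↔ G * F = F * G) (hF : IsTypeZ d F) (h : NotExactlyThree (dbar d)) :
    IsAlgebraicFor d D M F v := by
  have := numberField_quadField hD
  have hK := finrank_quadField hD
  have hn := dbar_ne_zero d
  obtain ⟨p, hp⟩ := exists_isCyclicVector_of_isConj hF
  obtain ⟨j, hj⟩ := exists_commutant_mulEquiv hp (sq_add_self_add_one htr hdet)
    (mk_sq_add_self_add_one hv ht) (bijective_linComb_mk hK ht3 hv hn ht h) M hM
  refine ⟨j, Or.inl ⟨hF, fun G a b hG => ?_⟩⟩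
  rw [hj G a b (by rw [hG, int_comb_eq]), linComb_intCast]
  simp

/-! ### A prime that ramifies -/

/-- An element of `P` outside `P²` gives a nonzero `ε` with `ε² = 0`. Then `s = 1 + ε` works,
because `s² + s + 1 = 3 + 3 ε + ε² = 0`. -/
theorem exists_ramified_generator {L : Type*} [Field L] [NumberField L]
    (hL : Module.finrank ℚ L = 2)
    (h : ∃ P : Ideal (𝓞 L), P.IsPrime ∧ P ^ 2 = Ideal.span {(3 : 𝓞 L)}) :
    ∃ s : modN (𝓞 L) 3, s ^ 2 + s + 1 = 0 ∧ Function.Bijective (linComb (ZMod 3) s) := by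
  obtain ⟨P, hP, hP2⟩ := h
  have h30 : (3 : 𝓞 L) ≠ 0 := by
    exact_mod_cast (Nat.cast_ne_zero.2 three_ne_zero : ((3 : ℕ) : 𝓞 L) ≠ 0)
  have hPbot : P ≠ ⊥ := by
    rintro rfl
    rw [← Ideal.zero_eq_bot, zero_pow two_ne_zero, eq_comm, Ideal.zero_eq_bot,
      Ideal.span_singleton_eq_bot] at hP2
    exact h30 hP2
  have hlt : P ^ 2 < P := by
    simpa using Ideal.pow_right_strictAnti P hPbot hP.ne_top (show 1 < 2 by norm_num)
  obtain ⟨x, hxP, hx⟩ := SetLike.exists_of_lt hlt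
  set ε : modN (𝓞 L) 3 := Ideal.Quotient.mk _ x with hε
  have h3 : (3 : modN (𝓞 L) 3) = 0 := by
    have := natCast_modN_self (𝓞 L) 3
    exact_mod_cast this
  have hε0 : ε ≠ 0 := by
    intro h0
    rw [hε, Ideal.Quotient.eq_zero_iff_mem] at h0
    apply hx
    rw [hP2]
    exact_mod_cast h0
  have hεε : ε * ε = 0 := by
    rw [hε, ← map_mul, Ideal.Quotient.eq_zero_iff_mem]
    have := Ideal.mul_mem_mul hxP hxP
    rw [← sq, hP2] at this
    exact_mod_cast this
  have hz : ∀ c : ZMod 3, algebraMap (ZMod 3) (modN (𝓞 L) 3) c * ε = 0 → c = 0 := by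
    intro c hc
    by_contra hc0
    obtain ⟨w, hw⟩ := (isUnit_iff_ne_zero.2 hc0).map (algebraMap (ZMod 3) (modN (𝓞 L) 3))
    rw [← hw] at hc
    exact hε0 (by simpa using hc)
  refine ⟨1 + ε, by linear_combination (1 + ε) * h3 + hεε,
    bijective_linComb_of_injective hL three_ne_zero ?_⟩
  rintro ⟨a, b⟩ ⟨a', b'⟩ hab
  simp only [linComb] at hab
  have h1 := hz (a + b - a' - b') (by
    simp only [map_sub, map_add]
    linear_combination ε * hab - (algebraMap (ZMod 3) (modN (𝓞 L) 3) b -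
      algebraMap (ZMod 3) (modN (𝓞 L) 3) b') * hεε)
  have h2 := hz (b - b') (by
    have h1' := congrArg (algebraMap (ZMod 3) (modN (𝓞 L) 3)) h1
    simp only [map_sub, map_add, map_zero] at h1' ⊢
    linear_combination hab - h1')
  exact Prod.ext (by linear_combination h1 - h2) (sub_eq_zero.1 h2)

/-- The pair of `1 + ε` modulo 3 and `v` modulo `d̄/3` is a root of `X² + X + 1` which, together
with 1, forms a basis of the product ring over `ℤ/d̄`. So the centralizer of `F` is isomorphic to
the units of that ring. -/
theorem exists_isSplitMap (hD : ¬ IsSquare D) (htr : F.1.trace = -1)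
    (hdet : F.1.det = 1) (ht3 : 3 ≤ t) (hv : v ^ 2 - t * v + 1 = 0) (ht : (dbar d : ℤ) ∣ t + 1)
    (hM : ∀ G, G ∈ M ↔ G * F = F * G) (hF : IsTypeZ d F) (h3 : 3 ∣ dbar d)
    (hco : Nat.Coprime 3 (dbar d / 3)) {L : Type*} [Field L] [NumberField L]
    (hL : Module.finrank ℚ L = 2)
    (hP : ∃ P : Ideal (𝓞 L), P.IsPrime ∧ P ^ 2 = Ideal.span {(3 : 𝓞 L)}) :
    ∃ φ : M ≃* (modN (𝓞 L) 3)ˣ × (modN (𝓞 (quadField D)) (dbar d / 3))ˣ,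
      IsSplitMap d D M F v h3 (𝓞 L) φ.toMonoidHom := by
  have := numberField_quadField hD
  have hK := finrank_quadField hD
  have hn := dbar_ne_zero d
  have : NeZero (dbar d) := ⟨hn⟩
  have hm : dbar d = 3 * (dbar d / 3) := (Nat.mul_div_cancel' h3).symm
  have hm0 : dbar d / 3 ≠ 0 := fun h => hn (by omega)
  have hmd : dbar d / 3 ∣ dbar d := Nat.div_dvd_of_dvd h3
  have htm := (Int.natCast_dvd_natCast.2 hmd).trans ht
  have := finite_modN hK hm0
  have := finite_modN hL three_ne_zero
  have hv' := mk_sq_add_self_add_one hv htm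
  have hbm := bijective_linComb_mk hK ht3 hv hm0 htm (notExactlyThree_of_coprime hco)
  obtain ⟨s, hs, hbs⟩ := exists_ramified_generator hL hP
  have hFF := sq_add_self_add_one htr hdet
  obtain ⟨p, hp⟩ := exists_isCyclicVector_of_isConj hF
  let _ : Algebra (ZMod (dbar d)) (modN (𝓞 L) 3 × modN (𝓞 (quadField D)) (dbar d / 3)) :=
    (((algebraMap (ZMod 3) (modN (𝓞 L) 3)).comp (ZMod.castHom h3 (ZMod 3))).prod
      ((algebraMap (ZMod (dbar d / 3)) (modN (𝓞 (quadField D)) (dbar d / 3))).comp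
        (ZMod.castHom hmd (ZMod (dbar d / 3))))).toAlgebra
  have hlin : ∀ a b : ZMod (dbar d),
      linComb (ZMod (dbar d))
        ((s, Ideal.Quotient.mk _ v) : modN (𝓞 L) 3 × modN (𝓞 (quadField D)) (dbar d / 3)) (a, b) =
      (linComb (ZMod 3) s (ZMod.castHom h3 (ZMod 3) a, ZMod.castHom h3 (ZMod 3) b),
        linComb (ZMod (dbar d / 3)) (Ideal.Quotient.mk _ v)
          (ZMod.castHom hmd (ZMod (dbar d / 3)) a, ZMod.castHom hmd (ZMod (dbar d / 3)) b)) :=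
    fun _ _ => rfl
  have hb : Function.Bijective (linComb (ZMod (dbar d))
      ((s, Ideal.Quotient.mk _ v) : modN (𝓞 L) 3 × modN (𝓞 (quadField D)) (dbar d / 3))) := by
    refine (Nat.bijective_iff_injective_and_card _).2 ⟨?_, ?_⟩
    · rintro ⟨a, b⟩ ⟨a', b'⟩ hab
      rw [hlin, hlin] at hab
      obtain ⟨h1, h2⟩ := Prod.mk.inj hab
      obtain ⟨h1a, h1b⟩ := Prod.mk.inj (hbs.1 h1)
      obtain ⟨h2a, h2b⟩ := Prod.mk.inj (hbm.1 h2)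
      exact Prod.ext (castHom_eq_of_coprime hco hm h3 hmd h1a h2a)
        (castHom_eq_of_coprime hco hm h3 hmd h1b h2b)
    · rw [Nat.card_prod, Nat.card_prod, card_modN hL, card_modN hK, Nat.card_zmod, ← mul_pow, ← hm,
        sq]
  obtain ⟨Θ, hΘ⟩ := exists_commutant_mulEquiv hp hFF (Prod.ext hs hv' :
    ((s, Ideal.Quotient.mk _ v) : modN (𝓞 L) 3 × modN (𝓞 (quadField D)) (dbar d / 3)) ^ 2 +
      (s, Ideal.Quotient.mk _ v) + 1 = 0) hb M hM
  have hcoeff : ∀ G : M, ∃ a b : ZMod (dbar d),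
      G.1.1 = a • (1 : Matrix (Fin 2) (Fin 2) (ZMod (dbar d))) + b • F.1 ∧
      (Θ G).1 = linComb (ZMod (dbar d))
        ((s, Ideal.Quotient.mk _ v) : modN (𝓞 L) 3 × modN (𝓞 (quadField D)) (dbar d / 3))
          (a, b) := by
    intro G
    obtain ⟨a, b, hab⟩ := hp.exists_eq (G := G.1.1) (congrArg Units.val ((hM _).1 G.2))
    exact ⟨a, b, hab, hΘ G a b hab⟩
  have hconj : ∀ {n : ℕ} (h : n ∣ dbar d),
      IsConj (reduceGL d h F) (zaunerMat n : GL (Fin 2) (ZMod n)) := by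
    intro n h
    have h1 := (reduceGL d h).map_isConj hF
    have h2 : reduceGL d h (zaunerMat (dbar d) : GL2 d) = (zaunerMat n : GL (Fin 2) (ZMod n)) := by
      apply Units.ext
      rw [coe_reduceGL]
      change Matrix.map !![0, -1; 1, -1] _ = !![0, -1; 1, -1]
      ext i j
      fin_cases i <;> fin_cases j <;> simp [-ZMod.castHom_apply]
    rwa [h2] at h1
  obtain ⟨p₃, hp₃⟩ := exists_isCyclicVector_of_isConj (hconj h3)
  obtain ⟨pₘ, hpₘ⟩ := exists_isCyclicVector_of_isConj (hconj hmd)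
  -- The first component of `Θ` depends only on the reduction modulo 3. It factors through an
  -- isomorphism `θ` on the centralizer of `F` modulo 3, which remains to be identified with `M_3`.
  let C₃ : Subgroup (GL (Fin 2) (ZMod 3)) := Subgroup.centralizer {reduceGL d h3 F}
  have hC₃ : ∀ G, G ∈ C₃ ↔ G * reduceGL d h3 F = reduceGL d h3 F * G := fun G => by
    rw [Subgroup.mem_centralizer_singleton_iff]
  obtain ⟨θ, hθ⟩ := exists_commutant_mulEquiv hp₃
    (sq_add_self_add_one (trace_reduceGL h3 htr) (det_reduceGL h3 hdet)) hs hbs C₃ hC₃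
  have hle : ∀ G : M, reduceGL d h3 G.1 ∈ C₃ := fun G =>
    (hC₃ _).2 (reduceGL_commute h3 ((hM _).1 G.2))
  have hθΘ : ∀ G : M, (θ ⟨_, hle G⟩ : modN (𝓞 L) 3) = (Θ G).1.1 := by
    intro G
    obtain ⟨a, b, hab, hG⟩ := hcoeff G
    rw [hθ _ _ _ (reduceGL_comb h3 hab), hG, hlin]
  have hM₃ : M.map (reduceGL d h3) = C₃ := by
    refine le_antisymm ?_ fun H hH => ?_
    · rintro _ ⟨G, hG, rfl⟩
      exact hle ⟨G, hG⟩
    -- Surjectivity of `Θ` lifts `H`: the preimage of `(θ H, 1)` reduces to `H`.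
    · let G := Θ.symm (MulEquiv.prodUnits.symm (θ ⟨H, hH⟩, 1))
      have h1 : θ ⟨_, hle G⟩ = θ ⟨H, hH⟩ := Units.ext (by
        rw [hθΘ]
        simp only [G, MulEquiv.apply_symm_apply]
        rfl)
      exact ⟨G.1, G.2, congrArg Subtype.val (θ.injective h1)⟩
  refine ⟨Θ.trans MulEquiv.prodUnits, ⟨(MulEquiv.subgroupCongr hM₃).trans θ, ?_, ?_⟩, ?_⟩
  · intro c G hG
    change (θ ⟨G.1, _⟩ : modN (𝓞 L) 3) = c
    rw [hθ _ (c : ZMod 3) ((0 : ℤ) : ZMod 3) (by rw [← int_comb_eq]; simpa using hG),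
      linComb_intCast]
    simp
  · intro G
    exact Units.ext (hθΘ G).symm
  · intro G a b hG
    obtain ⟨a', b', hab, hG'⟩ := hcoeff G
    rw [reduceGL_comb hmd hab, int_comb_eq] at hG
    obtain ⟨h1, h2⟩ := hpₘ.coeff_unique hG
    change (Θ G).1.2 = _
    rw [hG', hlin, h1, h2, linComb_intCast]
    simp

end Correspondence

end SIC

end

/-! ### The correspondence between orbits and ideal factors -/

theorem mainTheorem6 (d : ℕ) [NeZero d] (hd : 4 ≤ d)
    (D : ℕ) (hD : SIC.IsSquarefreePart D ((d - 3) * (d + 1)))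
    (z : ZMod d → ℂ) (hz : SIC.IsStronglyCentred d D z)
    (hM : SIC.IsMaximalAbelianIn (SIC.galM d D z)
      (Subgroup.centralizer (SIC.symGroup d z : Set (SIC.GL2 d))))
    (F : SIC.GL2 d) (hF : SIC.IsZaunerElement d z F)
    (u : (𝓞 (SIC.quadField D))ˣ) (hu : SIC.IsFundamentalUnit D u)
    (r : ℕ) (hr : SIC.HasRationalPart d D u r) :
    -- algebraic fiducials
    (∀ j : SIC.galM d D z ≃* (SIC.modN (𝓞 (SIC.quadField D)) (SIC.dbar d))ˣ,
      SIC.IsJHat d D (SIC.galM d D z) F (SIC.zaunerUnit d D u r) j →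
      SIC.IsOrbitCorrespondence (SIC.galM d D z)
        (fun n : SIC.IdealFactor (𝓞 (SIC.quadField D)) (SIC.dbar d) =>
          (SIC.piMap n).ker.comap j.toMonoidHom)) ∧
    -- non-algebraic fiducials (of type z): 3 is treated as if it ramifies
    (SIC.IsTypeZ d F →
      ¬ SIC.IsAlgebraicFor d D (SIC.galM d D z) F (SIC.zaunerUnit d D u r) →
      ∃ h3 : 3 ∣ SIC.dbar d, Nat.Coprime 3 (SIC.dbar d / 3) ∧
        ∀ (L : Type) [Field L] [NumberField L], Module.finrank ℚ L = 2 →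
          (∃ P : Ideal (𝓞 L), P.IsPrime ∧ P ^ 2 = Ideal.span {(3 : 𝓞 L)}) →
          (∃ φ : SIC.galM d D z ≃* (SIC.modN (𝓞 L) 3)ˣ ×
              (SIC.modN (𝓞 (SIC.quadField D)) (SIC.dbar d / 3))ˣ,
            SIC.IsSplitMap d D (SIC.galM d D z) F (SIC.zaunerUnit d D u r) h3 (𝓞 L)
              φ.toMonoidHom) ∧
          ∀ φ : SIC.galM d D z ≃* (SIC.modN (𝓞 L) 3)ˣ ×
              (SIC.modN (𝓞 (SIC.quadField D)) (SIC.dbar d / 3))ˣ,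
            SIC.IsSplitMap d D (SIC.galM d D z) F (SIC.zaunerUnit d D u r) h3 (𝓞 L)
              φ.toMonoidHom →
            SIC.IsOrbitCorrespondence (SIC.galM d D z)
              (fun n : SIC.IdealFactor (𝓞 L) 3 ×
                  SIC.IdealFactor (𝓞 (SIC.quadField D)) (SIC.dbar d / 3) =>
                ((SIC.piMap n.1).ker.prod (SIC.piMap n.2).ker).comap φ.toMonoidHom)) := by

  have hDs := SIC.not_isSquare_of_isSquarefreePart hd hD
  obtain ⟨t, ht3, ht, hv⟩ := SIC.exists_zaunerUnit_trace hd hDs u r hr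
  obtain ⟨hFS, -, htr, hdet⟩ := hF
  have hMF := fun G (hG : G ∈ SIC.galM d D z) => SIC.commute_of_mem_galM hM hFS hG
  have hneg := SIC.neg_one_mem_galM hM
  have hFF := SIC.sq_add_self_add_one htr hdet
  refine ⟨?_, fun hFz halg => ?_⟩
  · rintro j (⟨hFz, hj⟩ | ⟨hFa, h3, hj⟩)
    · obtain ⟨p, hp⟩ := SIC.exists_isCyclicVector_of_isConj hFz
      exact SIC.isOrbitCorrespondence_of_isTypeZ hDs hv ht (SIC.mem_galM_iff hM hFS hp) hFF hp j hj
    · exact SIC.isOrbitCorrespondence_of_not_isTypeZ hDs htr hdet hMF hneg ht3 hv ht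
        (SIC.coprime_three_div h3 (SIC.not_notExactlyThree_of_not_isTypeZ htr hdet hFa)) j hj
  · obtain ⟨p, hp⟩ := SIC.exists_isCyclicVector_of_isConj hFz
    have hMiff := SIC.mem_galM_iff hM hFS hp
    have h9 : ¬ SIC.NotExactlyThree (SIC.dbar d) := fun h =>
      halg (SIC.isAlgebraicFor_of_notExactlyThree hDs htr hdet ht3 hv ht hMiff hFz h)
    have h3 : 3 ∣ SIC.dbar d := by
      by_contra h3
      exact h9 fun h => absurd h h3
    have hco := SIC.coprime_three_div h3 h9
    exact ⟨h3, hco, fun L _ _ hL hP =>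
      ⟨SIC.exists_isSplitMap hDs htr hdet ht3 hv ht hMiff hFz h3 hco hL hP, fun φ hφ =>
        SIC.isOrbitCorrespondence_of_isSplitMap hDs htr hdet hMF hneg ht3 hv ht hco hL φ hφ⟩⟩
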